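/- Let $d\in\mathbb N$, $L>0$, $0<T<\infty$ and $2<p<\infty$. Let $\gamma\in W^{2,p}(\mathbb R/L\mathbb Z,\mathbb R^d)$ be a fixed closed curve, and let $\gamma_n=\gamma+\phi_n$, $n\in\mathbb N$, be time-dependent families of closed curves, $\gamma_n(t)=\gamma+\phi_n(t)\in W^{2,p}(\mathbb R/L\mathbb Z,\mathbb R^d)$ for $0\le t<T$. Suppose that: (i) $(\gamma_n)$ is bounded in $L^\infty\big([0,T),W^{2,p}(\mathbb R/L\mathbb Z,\mathbb R^d)\big)$ and in $C^{1/2}\big([0,T),L^2(\mathbb R/L\mathbb Z,\mathbb R^d)\big)$; (ii) the curves are uniformly regular: there is $c>0$ such that for all $n$ and almost every $t\in[0,T)$ one has $|\gamma_n'(t,x)|\ge c$ for almost every $x$, where $'$ denotes $\partial_x$; (iii) with $\kappa_n=\dfrac{P^\perp_{\gamma_n'}\gamma_n''}{|\gamma_n'|^2}$ the curvature vector of $\gamma_n$ (where $P^\perp_v$ is the orthogonal projection onto the orthogonal complement of $\mathbb R v$), the functions $|\kappa_n|^{p-2}\kappa_n$ are uniformly bounded in $L^2\big([0,T),W^{1,1}(\mathbb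 R/L\mathbb Z,\mathbb R^d)\big)$. Then every $\kappa_n$ belongs to $L^2\big([0,T),L^p(\mathbb R/L\mathbb Z,\mathbb R^d)\big)$, and there is a subsequence $(\gamma_{n_j})$ whose curvatures $\kappa_{n_j}$ converge strongly in $L^2\big([0,T),L^p(\mathbb R/L\mathbb Z,\mathbb R^d)\big)$. -/

import Mathlib

open MeasureTheory Filter Topology
open scoped ENNReal NNReal ContDiff

noncomputable section

/-- `g` is the weak derivative on the circle `ℝ/Lℤ` of `f`: for every smooth test function on the
circle (that is, every smooth `L`-periodic `ψ : ℝ → ℝ`) one has `∫ ψ' f = - ∫ ψ g` over one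
period.  It is only used for integrable `f` and `g`. -/
def HasWeakDeriv {L : ℝ} {E : Type*} [NormedAddCommGroup E] [NormedSpace ℝ E]
    (f g : AddCircle L → E) : Prop :=
  ∀ ψ : ℝ → ℝ, ContDiff ℝ ∞ ψ → Function.Periodic ψ L →
    ∫ x in (0 : ℝ)..L, deriv ψ x • f (x : AddCircle L)
      = - ∫ x in (0 : ℝ)..L, ψ x • g (x : AddCircle L)

theorem HasWeakDeriv.const_smul {L : ℝ} {E : Type*} [NormedAddCommGroup E] [NormedSpace ℝ E]
    {f g : AddCircle L → E} (c : ℝ) (h : HasWeakDeriv f g) :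
    HasWeakDeriv (c • f) (c • g) := by
  intro ψ hψ hper
  simp only [Pi.smul_apply, smul_comm _ c, intervalIntegral.integral_smul, h ψ hψ hper, smul_neg]

section Linear

variable {L : ℝ} [hL : Fact (0 < L)] {E : Type*} [NormedAddCommGroup E] [NormedSpace ℝ E]

theorem intervalIntegrable_smul_of_integrable {f : AddCircle L → E} (hf : Integrable f)
    {ψ : ℝ → ℝ} (hψ : Continuous ψ) :
    IntervalIntegrable (fun x : ℝ => ψ x • f (x : AddCircle L)) volume 0 L := by
  have h : IntervalIntegrable (fun x : ℝ => f (x : AddCircle L)) volume 0 L := by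
    rw [intervalIntegrable_iff_integrableOn_Ioc_of_le hL.out.le]
    have := (AddCircle.measurePreserving_mk L 0).integrable_comp_of_integrable hf
    rw [zero_add] at this
    exact this
  exact h.continuousOn_smul hψ.continuousOn

theorem HasWeakDeriv.add {f₁ f₂ g₁ g₂ : AddCircle L → E} (hf₁ : Integrable f₁)
    (hf₂ : Integrable f₂) (hg₁ : Integrable g₁) (hg₂ : Integrable g₂)
    (h₁ : HasWeakDeriv f₁ g₁) (h₂ : HasWeakDeriv f₂ g₂) :
    HasWeakDeriv (f₁ + f₂) (g₁ + g₂) := by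
  intro ψ hψ hper
  have hd : Continuous (deriv ψ) := hψ.continuous_deriv (by simp)
  simp only [Pi.add_apply, smul_add]
  rw [intervalIntegral.integral_add (intervalIntegrable_smul_of_integrable hf₁ hd)
      (intervalIntegrable_smul_of_integrable hf₂ hd),
    intervalIntegral.integral_add (intervalIntegrable_smul_of_integrable hg₁ hψ.continuous)
      (intervalIntegrable_smul_of_integrable hg₂ hψ.continuous), h₁ ψ hψ hper, h₂ ψ hψ hper]
  abel

theorem HasWeakDeriv.congr_ae {f₁ f₂ g₁ g₂ : AddCircle L → E} (hf : f₁ =ᵐ[volume] f₂)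
    (hg : g₁ =ᵐ[volume] g₂) (h : HasWeakDeriv f₁ g₁) : HasWeakDeriv f₂ g₂ := by
  intro ψ hψ hper
  have key : ∀ {u v : AddCircle L → E} (χ : ℝ → ℝ), u =ᵐ[volume] v →
      ∫ x in (0 : ℝ)..L, χ x • u (x : AddCircle L) = ∫ x in (0 : ℝ)..L, χ x • v (x : AddCircle L) := by
    intro u v χ huv
    rw [intervalIntegral.integral_of_le hL.out.le, intervalIntegral.integral_of_le hL.out.le]
    have h1 := (AddCircle.measurePreserving_mk L 0).quasiMeasurePreserving.ae huv
    rw [zero_add] at h1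
    refine integral_congr_ae ?_
    filter_upwards [h1] with x hx
    rw [hx]
  rw [← key _ hf, ← key _ hg]
  exact h ψ hψ hper

end Linear

section Sobolev

variable (L : ℝ) [Fact (0 < L)] (E : Type*) [NormedAddCommGroup E] [NormedSpace ℝ E]
  (q : ℝ≥0∞) [hq : Fact (1 ≤ q)]

/-- The Sobolev space `W^{1,q}(ℝ/Lℤ, E)`: the pairs `(u, u')` of elements of `L^q` in which `u'` is
the weak derivative of `u`.  It carries the norm `max (‖u‖_q) (‖u'‖_q)`, which is equivalent to the
other usual choices. -/
def SobolevOne : Submodule ℝ (Lp E q (volume : Measure (AddCircle L)) × Lp E q (volume : Measure (AddCircle L))) where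
  carrier := {u | HasWeakDeriv (u.1 : AddCircle L → E) (u.2 : AddCircle L → E)}
  add_mem' := by
    intro u v hu hv
    exact (HasWeakDeriv.add ((Lp.memLp _).integrable hq.out) ((Lp.memLp _).integrable hq.out)
      ((Lp.memLp _).integrable hq.out) ((Lp.memLp _).integrable hq.out) hu hv).congr_ae
      (Lp.coeFn_add _ _).symm (Lp.coeFn_add _ _).symm
  zero_mem' := by
    have h : HasWeakDeriv (0 : AddCircle L → E) (0 : AddCircle L → E) := by
      intro ψ _ _
      simp
    exact h.congr_ae (Lp.coeFn_zero _ _ _).symm (Lp.coeFn_zero _ _ _).symm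
  smul_mem' := by
    intro c u hu
    exact (HasWeakDeriv.const_smul c hu).congr_ae (Lp.coeFn_smul _ _).symm (Lp.coeFn_smul _ _).symm

/-- The Sobolev space `W^{2,q}(ℝ/Lℤ, E)`: the triples `(u, u', u'')` of elements of `L^q` in which
each of `u'`, `u''` is the weak derivative of the entry before it.  It carries the norm
`max (‖u‖_q) (‖u'‖_q) (‖u''‖_q)`, which is equivalent to the other usual choices. -/
def SobolevTwo : Submodule ℝ (Lp E q (volume : Measure (AddCircle L)) ×
    Lp E q (volume : Measure (AddCircle L)) × Lp E q (volume : Measure (AddCircle L))) where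
  carrier := {u | HasWeakDeriv (u.1 : AddCircle L → E) (u.2.1 : AddCircle L → E) ∧
    HasWeakDeriv (u.2.1 : AddCircle L → E) (u.2.2 : AddCircle L → E)}
  add_mem' := by
    intro u v hu hv
    exact ⟨(SobolevOne L E q).add_mem (x := (u.1, u.2.1)) (y := (v.1, v.2.1)) hu.1 hv.1,
      (SobolevOne L E q).add_mem (x := u.2) (y := v.2) hu.2 hv.2⟩
  zero_mem' := ⟨(SobolevOne L E q).zero_mem, (SobolevOne L E q).zero_mem⟩
  smul_mem' := by
    intro c u hu
    exact ⟨(SobolevOne L E q).smul_mem c (x := (u.1, u.2.1)) hu.1,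
      (SobolevOne L E q).smul_mem c (x := u.2) hu.2⟩

end Sobolev

section Curves

variable {L : ℝ} [Fact (0 < L)] {E : Type*} [NormedAddCommGroup E] [InnerProductSpace ℝ E]
  {q : ℝ≥0∞} [Fact (1 ≤ q)]

/-- The function underlying an element of `W^{1,q}`. -/
def SobolevOne.toFun (u : SobolevOne L E q) : AddCircle L → E := u.1.1

/-- The function underlying an element of `W^{2,q}`. -/
def SobolevTwo.toFun (u : SobolevTwo L E q) : AddCircle L → E := u.1.1

/-- The first derivative `u'`. -/
def SobolevTwo.d1 (u : SobolevTwo L E q) : AddCircle L → E := u.1.2.1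

/-- The second derivative `u''`. -/
def SobolevTwo.d2 (u : SobolevTwo L E q) : AddCircle L → E := u.1.2.2

/-- The orthogonal projection `P^⊥_v w` of `w` onto the orthogonal complement of the line `ℝ v`. -/
def normalProj (v w : E) : E := w - inner ℝ w (‖v‖⁻¹ • v) • (‖v‖⁻¹ • v)

/-- The curvature vector `κ = ∂_s² γ = P^⊥_{γ'} γ'' / |γ'|²` of a regular `W^{2,q}` curve,
where `∂_s = |γ'|⁻¹ ∂_x`. -/
def curvature (γ : SobolevTwo L E q) : AddCircle L → E :=
  fun x => (‖SobolevTwo.d1 γ x‖ ^ 2)⁻¹ • normalProj (SobolevTwo.d1 γ x) (SobolevTwo.d2 γ x)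

open Classical in
/-- The curvature as an element of `L^q` (and zero if the curvature is not in `L^q`). -/
def curvatureLp (γ : SobolevTwo L E q) : Lp E q (volume : Measure (AddCircle L)) :=
  if h : MemLp (curvature γ) q volume then h.toLp (curvature γ) else 0

end Curves

/-- Lebesgue measure on the time interval `[0, T)`. -/
def timeMeasure (T : ℝ) : Measure ℝ := volume.restrict (Set.Ico 0 T)

/-- The sequence `u` is bounded in the Bochner space `L^r([0, T), X)`. -/
def BoundedInBochner {X : Type*} [NormedAddCommGroup X] (T : ℝ) (r : ℝ≥0∞) (u : ℕ → ℝ → X) : Prop :=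
  ∃ C : ℝ≥0, ∀ n, AEStronglyMeasurable (u n) (timeMeasure T) ∧ eLpNorm (u n) r (timeMeasure T) ≤ C

/-- The sequence `u` of time-dependent functions on the circle is bounded in
`C^{1/2}([0, T), L²(ℝ/Lℤ, E))`. -/
def BoundedInHolderHalf {L : ℝ} [Fact (0 < L)] {E : Type*} [NormedAddCommGroup E] (T : ℝ)
    (u : ℕ → ℝ → AddCircle L → E) : Prop :=
  ∃ C : ℝ≥0, ∀ n,
    (∀ t ∈ Set.Ico 0 T, eLpNorm (u n t) 2 volume ≤ C) ∧
    ∀ s ∈ Set.Ico 0 T, ∀ t ∈ Set.Ico 0 T,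
      eLpNorm (u n s - u n t) 2 volume ≤ C * ENNReal.ofReal (√|s - t|)

end

/-! The heart is a stability estimate for two curves at one time. Let `h = ‖κ‖ ^ (p - 2) κ`, with
weak derivative `g`, and let `τ = γ' / ‖γ'‖`. Strong monotonicity of `a ↦ ‖a‖ ^ (p - 2) a` bounds
`‖κ₁ - κ₂‖ ^ p` by a multiple of `⟨h₁ - h₂, κ₁ - κ₂⟩`. Since `‖γ'‖ κ = τ'`, weighting by `‖γ₁'‖`
replaces `κ₁ - κ₂` by `τ₁' - τ₂'` up to an error `(‖γ₂'‖ - ‖γ₁'‖) κ₂`. Integration by parts on the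
circle moves the derivative onto `h₁ - h₂`, leaving `⟨g₁ - g₂, τ₁ - τ₂⟩`. As `g` is bounded in `L¹`
and `h` in `L^∞` by the `W^{1,1}` norm, everything is at most a constant times `‖γ₁' - γ₂'‖_∞` times
the `W^{1,1}` norms (`integral_curvatureOf_sub_rpow_le`).

It remains to make `γ_n'` uniformly Cauchy. Arzelà–Ascoli at countably many times and the Hölder
bound in time give a subsequence that is Cauchy in `L²`, uniformly in time
(`SobolevTwo.exists_subseq_uniformly_cauchy`). Interpolation against the `W^{2,p}` bound upgrades
this to `C¹` (`ae_norm_sq_le_of_hasWeakDeriv`). Taking `p`-th roots and integrating in time makes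
the curvatures Cauchy in `L² L^p`, which is complete. -/

/-! ### Calculus of absolutely continuous functions on an interval. -/

/-- `F` is the (absolutely continuous) primitive of the integrable function `f` on `[a, b]`. -/
structure IsPrimitiveOn {E : Type*} [NormedAddCommGroup E] [NormedSpace ℝ E]
    (F f : ℝ → E) (a b : ℝ) : Prop where
  intervalIntegrable : IntervalIntegrable f volume a b
  eq_add_integral : ∀ x ∈ Set.Icc a b, F x = F a + ∫ t in a..x, f t

namespace IsPrimitiveOn

variable {E : Type*} [NormedAddCommGroup E] [NormedSpace ℝ E] {F f : ℝ → E} {a b : ℝ}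

theorem sub_eq_integral (h : IsPrimitiveOn F f a b) {x y : ℝ} (hx : x ∈ Set.Icc a b)
    (hy : y ∈ Set.Icc a b) : F y - F x = ∫ t in x..y, f t := by
  have hi : ∀ z ∈ Set.Icc a b, IntervalIntegrable f volume a z := fun z hz =>
    h.intervalIntegrable.mono_set (by
      rw [Set.uIcc_of_le hz.1, Set.uIcc_of_le (hz.1.trans hz.2)]
      exact Set.Icc_subset_Icc_right hz.2)
  rw [h.eq_add_integral x hx, h.eq_add_integral y hy,
    ← intervalIntegral.integral_interval_sub_left (hi y hy) (hi x hx)]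
  abel

theorem norm_sub_le (h : IsPrimitiveOn F f a b) {x y : ℝ} (hx : x ∈ Set.Icc a b)
    (hy : y ∈ Set.Icc a b) (hxy : x ≤ y) : ‖F y - F x‖ ≤ ∫ t in x..y, ‖f t‖ := by
  rw [h.sub_eq_integral hx hy]
  exact intervalIntegral.norm_integral_le_integral_norm hxy

theorem norm_sub_le_total (h : IsPrimitiveOn F f a b) {x y : ℝ} (hx : x ∈ Set.Icc a b)
    (hy : y ∈ Set.Icc a b) : ‖F y - F x‖ ≤ ∫ t in a..b, ‖f t‖ := by
  wlog hxy : x ≤ y generalizing x y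
  · rw [norm_sub_rev]; exact this hy hx (le_of_not_ge hxy)
  refine (h.norm_sub_le hx hy hxy).trans ?_
  exact intervalIntegral.integral_mono_interval hx.1 hxy hy.2
    (Eventually.of_forall fun t => norm_nonneg _) h.intervalIntegrable.norm

theorem continuousOn (h : IsPrimitiveOn F f a b) : ContinuousOn F (Set.Icc a b) := by
  rcases le_total a b with hab | hab
  · have h1 := intervalIntegral.continuousOn_primitive_interval' h.intervalIntegrable
      (a := a) Set.left_mem_uIcc
    rw [Set.uIcc_of_le hab] at h1
    exact (continuousOn_const.add h1).congr h.eq_add_integral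
  · exact (Set.subsingleton_Icc_of_ge hab).continuousOn F

theorem ae_hasDerivAt [CompleteSpace E] (h : IsPrimitiveOn F f a b) :
    ∀ᵐ x, x ∈ Set.Icc a b → HasDerivAt F (f x) x := by
  have h₁ : ∀ᵐ x : ℝ, x ≠ a := by simp [ae_iff, measure_singleton]
  have h₂ : ∀ᵐ x : ℝ, x ≠ b := by simp [ae_iff, measure_singleton]
  filter_upwards [h.intervalIntegrable.ae_hasDerivAt_integral, h₁, h₂] with x hx hxa hxb hxI
  have hab : a ≤ b := hxI.1.trans hxI.2
  rw [Set.uIcc_of_le hab] at hx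
  have hd := (hx hxI a (Set.left_mem_Icc.2 hab)).const_add (F a)
  refine hd.congr_of_eventuallyEq ?_
  filter_upwards [Icc_mem_nhds (lt_of_le_of_ne hxI.1 hxa.symm) (lt_of_le_of_ne hxI.2 hxb)]
    with y hy using h.eq_add_integral y hy

theorem mono (h : IsPrimitiveOn F f a b) {c : ℝ} (hc : c ∈ Set.Icc a b) :
    IsPrimitiveOn F f a c where
  intervalIntegrable := h.intervalIntegrable.mono_set (by
      rw [Set.uIcc_of_le hc.1, Set.uIcc_of_le (hc.1.trans hc.2)]
      exact Set.Icc_subset_Icc_right hc.2)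
  eq_add_integral x hx := h.eq_add_integral x ⟨hx.1, hx.2.trans hc.2⟩

theorem sub {G g : ℝ → E} (hF : IsPrimitiveOn F f a b) (hG : IsPrimitiveOn G g a b) :
    IsPrimitiveOn (fun x => F x - G x) (fun x => f x - g x) a b where
  intervalIntegrable := hF.intervalIntegrable.sub hG.intervalIntegrable
  eq_add_integral x hx := by
    rw [intervalIntegral.integral_sub (hF.mono hx).intervalIntegrable
      (hG.mono hx).intervalIntegrable, hF.eq_add_integral x hx, hG.eq_add_integral x hx]
    abel

/-- The common source of the product and chain rules. The increments of `F - P` are dominated by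
those of the scalar primitive of `m + ‖f‖`, so `F - P` is absolutely continuous with derivative zero
almost everywhere, hence constant. -/
theorem of_dominated [CompleteSpace E] {m : ℝ → ℝ} (hab : a ≤ b)
    (hm : IntervalIntegrable m volume a b)
    (hF : ∀ x ∈ Set.Icc a b, ∀ y ∈ Set.Icc a b, x ≤ y → ‖F y - F x‖ ≤ ∫ t in x..y, m t)
    (hd : ∀ᵐ x, x ∈ Set.Icc a b → HasDerivAt F (f x) x)
    (hf : IntervalIntegrable f volume a b) : IsPrimitiveOn F f a b := by
  refine ⟨hf, ?_⟩
  set P : ℝ → E := fun x => ∫ t in a..x, f t with hP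
  have hprim : IsPrimitiveOn P f a b := ⟨hf, fun x _ => by simp [hP]⟩
  set m' : ℝ → ℝ := fun t => m t + ‖f t‖ with hm'
  have hm'i : IntervalIntegrable m' volume a b := hm.add hf.norm
  set R : ℝ → ℝ := fun x => ∫ t in a..x, m' t with hR
  have hRp : IsPrimitiveOn R m' a b := ⟨hm'i, fun x _ => by simp [hR]⟩
  have hRac : AbsolutelyContinuousOnInterval R a b :=
    hm'i.absolutelyContinuousOnInterval_intervalIntegral (by simp)
  have hsub : ∀ {x y : ℝ}, x ∈ Set.Icc a b → y ∈ Set.Icc a b → x ≤ y →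
      Set.uIcc x y ⊆ Set.uIcc a b := fun hx hy hxy => by
    rw [Set.uIcc_of_le hxy, Set.uIcc_of_le hab]; exact Set.Icc_subset_Icc hx.1 hy.2
  have key : ∀ x ∈ Set.Icc a b, ∀ y ∈ Set.Icc a b,
      dist (F x - P x) (F y - P y) ≤ dist (R x) (R y) := by
    intro x hx y hy
    wlog hxy : x ≤ y generalizing x y
    · rw [dist_comm, dist_comm (R x)]; exact this y hy x hx (le_of_not_ge hxy)
    rw [dist_comm, dist_comm (R x), dist_eq_norm, Real.dist_eq, hRp.sub_eq_integral hx hy]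
    refine le_trans ?_ (le_abs_self _)
    rw [hm', intervalIntegral.integral_add (hm.mono_set (hsub hx hy hxy))
      (hf.norm.mono_set (hsub hx hy hxy))]
    calc ‖F y - P y - (F x - P x)‖ = ‖(F y - F x) - (P y - P x)‖ := by congr 1; abel
      _ ≤ ‖F y - F x‖ + ‖P y - P x‖ := _root_.norm_sub_le _ _
      _ ≤ _ := add_le_add (hF x hx y hy hxy) (hprim.norm_sub_le hx hy hxy)
  have hac : AbsolutelyContinuousOnInterval (fun x => F x - P x) a b := by
    rw [absolutelyContinuousOnInterval_iff] at hRac ⊢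
    intro ε hε
    obtain ⟨δ, hδ, h⟩ := hRac ε hε
    refine ⟨δ, hδ, fun I hI hlt => lt_of_le_of_lt (Finset.sum_le_sum fun i hi => ?_) (h I hI hlt)⟩
    have := hI.1 i hi
    rw [Set.uIcc_of_le hab] at this
    exact key _ this.1 _ this.2
  have h0 : ∀ᵐ x, x ∈ Set.uIcc a b → HasDerivAt (fun x => F x - P x) 0 x := by
    rw [Set.uIcc_of_le hab]
    filter_upwards [hd, hprim.ae_hasDerivAt] with x h1 h2 hx
    rw [← sub_self (f x)]
    exact (h1 hx).sub (h2 hx)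
  obtain ⟨C, hC⟩ := hac.const_of_ae_hasDerivAt_zero h0
  rw [Set.uIcc_of_le hab] at hC
  intro x hx
  have h1 := hC x hx
  have h2 := hC a (Set.left_mem_Icc.2 hab)
  simp only [hP, intervalIntegral.integral_same, sub_zero] at h1 h2
  rw [h2, ← h1]
  abel

theorem exists_bound (h : IsPrimitiveOn F f a b) :
    ∃ K, 0 ≤ K ∧ ∀ x ∈ Set.Icc a b, ‖F x‖ ≤ K := by
  obtain ⟨K, hK⟩ := isCompact_Icc.exists_bound_of_continuousOn h.continuousOn
  exact ⟨max K 0, le_max_right _ _, fun x hx => (hK x hx).trans (le_max_left _ _)⟩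

theorem bilinear {E₂ E₃ : Type*} [NormedAddCommGroup E₂] [NormedSpace ℝ E₂]
    [NormedAddCommGroup E₃] [NormedSpace ℝ E₃] [CompleteSpace E] [CompleteSpace E₂]
    [CompleteSpace E₃] {G g : ℝ → E₂} (B : E →L[ℝ] E₂ →L[ℝ] E₃) (hab : a ≤ b)
    (hF : IsPrimitiveOn F f a b) (hG : IsPrimitiveOn G g a b) :
    IsPrimitiveOn (fun x => B (F x) (G x)) (fun x => B (F x) (g x) + B (f x) (G x)) a b := by
  obtain ⟨K, hK0, hK⟩ := hF.exists_bound
  obtain ⟨K', hK'0, hK'⟩ := hG.exists_bound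
  have hi : IntervalIntegrable (fun x => B (F x) (g x) + B (f x) (G x)) volume a b := by
    have hFm : AEStronglyMeasurable F (volume.restrict (Set.Ioc a b)) :=
      (hF.continuousOn.mono Set.Ioc_subset_Icc_self).aestronglyMeasurable measurableSet_Ioc
    have hGm : AEStronglyMeasurable G (volume.restrict (Set.Ioc a b)) :=
      (hG.continuousOn.mono Set.Ioc_subset_Icc_self).aestronglyMeasurable measurableSet_Ioc
    have hfi := (intervalIntegrable_iff_integrableOn_Ioc_of_le hab).1 hF.intervalIntegrable
    have hgi := (intervalIntegrable_iff_integrableOn_Ioc_of_le hab).1 hG.intervalIntegrable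
    rw [intervalIntegrable_iff_integrableOn_Ioc_of_le hab]
    refine Integrable.add ?_ ?_
    · refine (hgi.norm.const_mul (‖B‖ * K)).mono'
        (B.aestronglyMeasurable_comp₂ hFm hgi.aestronglyMeasurable) ?_
      filter_upwards [ae_restrict_mem measurableSet_Ioc] with x hx
      refine (B.le_opNorm₂ _ _).trans ?_
      gcongr
      exact hK x (Set.Ioc_subset_Icc_self hx)
    · refine (hfi.norm.const_mul (‖B‖ * K')).mono'
        (B.aestronglyMeasurable_comp₂ hfi.aestronglyMeasurable hGm) ?_
      filter_upwards [ae_restrict_mem measurableSet_Ioc] with x hx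
      refine (B.le_opNorm₂ _ _).trans ?_
      rw [mul_assoc, mul_assoc, mul_comm K']
      gcongr
      exact hK' x (Set.Ioc_subset_Icc_self hx)
  refine of_dominated (m := fun t => ‖B‖ * K * ‖g t‖ + ‖B‖ * K' * ‖f t‖) hab
    ((hG.intervalIntegrable.norm.const_mul _).add (hF.intervalIntegrable.norm.const_mul _))
    ?_ ?_ hi
  · intro x hx y hy hxy
    have hsub : Set.uIcc x y ⊆ Set.uIcc a b := by
      rw [Set.uIcc_of_le hxy, Set.uIcc_of_le hab]; exact Set.Icc_subset_Icc hx.1 hy.2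
    rw [intervalIntegral.integral_add
      ((hG.intervalIntegrable.norm.mono_set hsub).const_mul _)
      ((hF.intervalIntegrable.norm.mono_set hsub).const_mul _),
      intervalIntegral.integral_const_mul, intervalIntegral.integral_const_mul]
    have e : B (F y) (G y) - B (F x) (G x) = B (F y) (G y - G x) + B (F y - F x) (G x) := by
      simp only [map_sub, _root_.sub_apply]; abel
    rw [e]
    refine (norm_add_le _ _).trans (add_le_add ?_ ?_)
    · refine (B.le_opNorm₂ _ _).trans ?_
      gcongr
      · exact hK y hy
      · exact hG.norm_sub_le hx hy hxy
    · refine (B.le_opNorm₂ _ _).trans ?_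
      rw [mul_assoc, mul_assoc, mul_comm K']
      gcongr
      · exact intervalIntegral.integral_nonneg hxy fun t _ => norm_nonneg _
      · exact hF.norm_sub_le hx hy hxy
      · exact hK' x hx
  · filter_upwards [hF.ae_hasDerivAt, hG.ae_hasDerivAt] with x h1 h2 hx
    exact B.hasDerivAt_of_bilinear (fun _ => h1 hx) (fun _ => h2 hx)

/-- The Lipschitz bound is asked only along the values of `F`, because the intended `φ`, namely `v ↦
v / ‖v‖`, is Lipschitz only away from the origin. -/
theorem comp_lipschitz {E₂ : Type*} [NormedAddCommGroup E₂] [NormedSpace ℝ E₂]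
    [CompleteSpace E] [CompleteSpace E₂] {φ : E → E₂} {D : E → E →L[ℝ] E₂} {K : ℝ} (hab : a ≤ b)
    (hF : IsPrimitiveOn F f a b)
    (hlip : ∀ x ∈ Set.Icc a b, ∀ y ∈ Set.Icc a b, ‖φ (F y) - φ (F x)‖ ≤ K * ‖F y - F x‖)
    (hK : 0 ≤ K)
    (hD : ∀ x ∈ Set.Icc a b, HasFDerivAt φ (D (F x)) (F x))
    (hi : IntervalIntegrable (fun x => D (F x) (f x)) volume a b) :
    IsPrimitiveOn (fun x => φ (F x)) (fun x => D (F x) (f x)) a b := by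
  refine of_dominated (m := fun t => K * ‖f t‖) hab (hF.intervalIntegrable.norm.const_mul _)
    ?_ ?_ hi
  · intro x hx y hy hxy
    rw [intervalIntegral.integral_const_mul]
    exact (hlip x hx y hy).trans (mul_le_mul_of_nonneg_left (hF.norm_sub_le hx hy hxy) hK)
  · filter_upwards [hF.ae_hasDerivAt] with x h1 hx
    exact (hD x hx).comp_hasDerivAt x (h1 hx)

end IsPrimitiveOn

/-! ### Weak derivatives on the circle and their continuous representatives. -/

section Circle

variable {L : ℝ} [hL : Fact (0 < L)] {E : Type*} [NormedAddCommGroup E] [NormedSpace ℝ E]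

theorem AddCircle.ae_iff_ae_Ioc {P : AddCircle L → Prop} :
    (∀ᵐ x : AddCircle L, P x) ↔ ∀ᵐ x : ℝ, x ∈ Set.Ioc 0 L → P (x : AddCircle L) := by
  constructor
  · intro h
    have h1 := (AddCircle.measurePreserving_mk L 0).quasiMeasurePreserving.ae h
    rw [zero_add] at h1
    exact (ae_restrict_iff' measurableSet_Ioc).1 h1
  · intro h
    have h2 : ∀ᵐ y : Set.Ioc (0 : ℝ) (0 + L) ∂(Measure.comap Subtype.val volume),
        P ((y : ℝ) : AddCircle L) := by
      rw [← (MeasurableEmbedding.subtype_coe (measurableSet_Ioc)).ae_map_iff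
        (p := fun y : ℝ => P (y : AddCircle L)), map_comap_subtype_coe measurableSet_Ioc, zero_add]
      exact (ae_restrict_iff' measurableSet_Ioc).2 h
    have h3 := (AddCircle.measurePreserving_equivIoc L (a := 0)).quasiMeasurePreserving.ae h2
    filter_upwards [h3] with x hx
    have : ((AddCircle.equivIoc L 0 x : ℝ) : AddCircle L) = x :=
      (AddCircle.equivIoc L 0).symm_apply_apply x
    rwa [this] at hx

theorem AddCircle.integral_eq_intervalIntegral (f : AddCircle L → E) :
    ∫ x, f x = ∫ x in (0 : ℝ)..L, f (x : AddCircle L) := by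
  have := AddCircle.intervalIntegral_preimage L 0 f
  rw [zero_add] at this
  exact this.symm

theorem MeasureTheory.Integrable.intervalIntegrable_coe {f : AddCircle L → E} (hf : Integrable f) :
    IntervalIntegrable (fun x : ℝ => f (x : AddCircle L)) volume 0 L := by
  simpa using intervalIntegrable_smul_of_integrable hf (ψ := fun _ => 1) continuous_const

omit hL in
theorem contDiff_fourier (n : ℤ) :
    ContDiff ℝ ∞ (fun x : ℝ => fourier n (x : AddCircle L)) := by
  simp_rw [fourier_coe_apply]
  have : ContDiff ℝ ∞ (fun x : ℝ => (x : ℂ)) := Complex.ofRealCLM.contDiff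
  fun_prop

/-- A nonconstant Fourier mode is itself the derivative of a smooth periodic function. The complex
factor `c` makes real parts cover both sines and cosines. -/
theorem integral_re_fourier_smul_eq_zero {F : ℝ → E}
    (hF : ∀ ψ : ℝ → ℝ, ContDiff ℝ ∞ ψ → Function.Periodic ψ L →
      ∫ x in (0 : ℝ)..L, deriv ψ x • F x = 0) {n : ℤ} (hn : n ≠ 0) (c : ℂ) :
    ∫ x in (0 : ℝ)..L, (c * fourier n (x : AddCircle L)).re • F x = 0 := by
  set k : ℂ := (L : ℂ) / (-2 * Real.pi * Complex.I * (-n : ℤ)) with hk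
  have hder : ∀ x : ℝ, HasDerivAt (fun y : ℝ => (c * (k * fourier n (y : AddCircle L))).re)
      (c * fourier n (x : AddCircle L)).re x := by
    intro x
    have h := has_antideriv_at_fourier_neg hL (neg_ne_zero.2 hn) x
    rw [neg_neg] at h
    exact Complex.reCLM.hasFDerivAt.comp_hasDerivAt x (h.const_mul c)
  have h := hF (fun y : ℝ => (c * (k * fourier n (y : AddCircle L))).re)
    (Complex.reCLM.contDiff.comp (contDiff_const.mul (contDiff_const.mul (contDiff_fourier n))))
    (fun y => by simp only [AddCircle.coe_add_period])
  simpa only [(hder _).deriv] using h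

/-- Trigonometric polynomials are uniformly dense, and pairing with the integrable `F` is continuous
for the sup norm. -/
theorem integral_re_smul_eq_zero_of_fourier {F : ℝ → E} (hF : IntervalIntegrable F volume 0 L)
    (h : ∀ (n : ℤ) (c : ℂ), ∫ x in (0 : ℝ)..L, (c * fourier n (x : AddCircle L)).re • F x = 0)
    (ϕ : C(AddCircle L, ℂ)) : ∫ x in (0 : ℝ)..L, (ϕ (x : AddCircle L)).re • F x = 0 := by
  have hint : ∀ ϕ : C(AddCircle L, ℂ),
      IntervalIntegrable (fun x : ℝ => (ϕ (x : AddCircle L)).re • F x) volume 0 L := fun ϕ =>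
    hF.continuousOn_smul (Complex.continuous_re.comp
      (ϕ.continuous.comp (AddCircle.continuous_mk' L))).continuousOn
  -- Quantifying over `c` makes the claim stable under complex scalars, although taking real parts
  -- is only real linear.
  have hspan : ∀ ϕ ∈ Submodule.span ℂ (Set.range (@fourier L)), ∀ c : ℂ,
      ∫ x in (0 : ℝ)..L, ((c • ϕ) (x : AddCircle L)).re • F x = 0 := by
    intro ϕ hϕ
    induction hϕ using Submodule.span_induction with
    | mem x hx => obtain ⟨n, rfl⟩ := hx; exact fun c => h n c
    | zero => intro c; simp
    | add x y _ _ hx hy =>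
      intro c
      have h1 := intervalIntegral.integral_add (hint (c • x)) (hint (c • y))
      rw [hx c, hy c, add_zero] at h1
      rw [← h1]
      congr 1
      ext t
      rw [smul_add, ContinuousMap.add_apply, Complex.add_re, add_smul]
    | smul a x _ hx => intro c; rw [smul_smul]; exact hx _
  have hbound : ∀ ϕ : C(AddCircle L, ℂ), ‖∫ x in (0 : ℝ)..L, (ϕ (x : AddCircle L)).re • F x‖
      ≤ ‖ϕ‖ * ∫ x in (0 : ℝ)..L, ‖F x‖ := by
    intro ϕ
    rw [← intervalIntegral.integral_const_mul]
    refine intervalIntegral.norm_integral_le_of_norm_le hL.out.le (Eventually.of_forall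
      fun x _ => ?_) (hF.norm.const_mul _)
    rw [norm_smul]
    gcongr
    exact (Complex.abs_re_le_norm _).trans (ϕ.norm_coe_le_norm _)
  have hmem : ϕ ∈ (Submodule.span ℂ (Set.range (@fourier L))).topologicalClosure := by
    rw [span_fourier_closure_eq_top]; trivial
  rw [← norm_le_zero_iff]
  refine le_of_forall_pos_le_add fun ε hε => ?_
  set K := ∫ x in (0 : ℝ)..L, ‖F x‖ with hK
  have hK0 : 0 ≤ K := intervalIntegral.integral_nonneg hL.out.le fun x _ => norm_nonneg _
  obtain ⟨P, hP, hd⟩ := Metric.mem_closure_iff.1 hmem (ε / (K + 1)) (by positivity)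
  have h1 : ∫ x in (0 : ℝ)..L, ((ϕ - P) (x : AddCircle L)).re • F x
      = ∫ x in (0 : ℝ)..L, (ϕ (x : AddCircle L)).re • F x := by
    have h2 := intervalIntegral.integral_sub (hint ϕ) (hint P)
    have h3 := hspan P hP 1
    rw [one_smul] at h3
    rw [h3, sub_zero] at h2
    rw [← h2]
    congr 1
    ext t
    rw [ContinuousMap.sub_apply, Complex.sub_re, sub_smul]
  rw [← h1, zero_add]
  refine (hbound _).trans ?_
  rw [dist_eq_norm] at hd
  calc ‖ϕ - P‖ * K ≤ ε / (K + 1) * (K + 1) := by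
        gcongr
        linarith
    _ = ε := by field_simp

/-- The lemma of du Bois-Reymond on the circle. -/
theorem exists_ae_eq_const_of_integral_deriv_smul_eq_zero [CompleteSpace E] {F : ℝ → E}
    (hFi : IntervalIntegrable F volume 0 L)
    (hF : ∀ ψ : ℝ → ℝ, ContDiff ℝ ∞ ψ → Function.Periodic ψ L →
      ∫ x in (0 : ℝ)..L, deriv ψ x • F x = 0) :
    ∃ a : E, ∀ᵐ x : ℝ, x ∈ Set.Ioc 0 L → F x = a := by
  -- The constant is the mean value: subtracting it kills the zeroth Fourier mode, the only one that
  -- is not a derivative.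
  set a : E := L⁻¹ • ∫ x in (0 : ℝ)..L, F x with ha
  refine ⟨a, ?_⟩
  set F0 : ℝ → E := fun x => F x - a with hF0
  have hF0i : IntervalIntegrable F0 volume 0 L := hFi.sub intervalIntegrable_const
  have hmean : ∫ x in (0 : ℝ)..L, F0 x = 0 := by
    rw [hF0, intervalIntegral.integral_sub hFi intervalIntegrable_const,
      intervalIntegral.integral_const, ha, smul_smul, sub_zero, mul_inv_cancel₀ hL.out.ne', one_smul,
      sub_self]
  have hF0z : ∀ ψ : ℝ → ℝ, ContDiff ℝ ∞ ψ → Function.Periodic ψ L →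
      ∫ x in (0 : ℝ)..L, deriv ψ x • F0 x = 0 := by
    intro ψ hψ hper
    have hd : Continuous (deriv ψ) := hψ.continuous_deriv (by simp)
    simp only [hF0, smul_sub]
    rw [intervalIntegral.integral_sub (hFi.continuousOn_smul hd.continuousOn)
      (Continuous.intervalIntegrable (by fun_prop) _ _), hF ψ hψ hper,
      intervalIntegral.integral_smul_const, intervalIntegral.integral_deriv_eq_sub
        (fun x _ => (hψ.differentiable (by simp)) x) (hd.intervalIntegrable _ _)]
    have : ψ L = ψ 0 := by simpa using hper 0
    simp [this]
  have hfour : ∀ (n : ℤ) (c : ℂ),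
      ∫ x in (0 : ℝ)..L, (c * fourier n (x : AddCircle L)).re • F0 x = 0 := by
    intro n c
    rcases eq_or_ne n 0 with rfl | hn
    · simp only [fourier_zero, mul_one, intervalIntegral.integral_smul, hmean, smul_zero]
    · exact integral_re_fourier_smul_eq_zero hF0z hn c
  have hcont := integral_re_smul_eq_zero_of_fourier hF0i hfour
  have hloc : LocallyIntegrableOn F0 (Set.Ioo 0 L) (volume.restrict (Set.Ioc 0 L)) := by
    have : Integrable F0 (volume.restrict (Set.Ioc 0 L)) :=
      (intervalIntegrable_iff_integrableOn_Ioc_of_le hL.out.le).1 hF0i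
    exact this.locallyIntegrable.locallyIntegrableOn _
  have hz := isOpen_Ioo.ae_eq_zero_of_integral_contDiff_smul_eq_zero hloc ?_
  · have h₂ : ∀ᵐ x : ℝ, x ≠ L := by simp [ae_iff, measure_singleton]
    filter_upwards [(ae_restrict_iff' measurableSet_Ioc).1 hz, h₂] with x hx hxL hxI
    exact sub_eq_zero.1 (hx hxI ⟨hxI.1, lt_of_le_of_ne hxI.2 hxL⟩)
  -- A test function supported in `(0, L)` descends to a continuous function on the circle, where
  -- the vanishing is already known.
  · intro g hg _ hsupp
    have hg0 : ∀ x, x ∉ Set.Ioo 0 L → g x = 0 := fun x hx =>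
      image_eq_zero_of_notMem_tsupport fun h => hx (hsupp h)
    have hlift : Continuous (AddCircle.liftIoc L 0 fun x => (g x : ℂ)) :=
      AddCircle.liftIoc_zero_continuous (by rw [hg0 0 (by simp), hg0 L (by simp)])
        (Complex.continuous_ofReal.comp hg.continuous).continuousOn
    have h := hcont ⟨_, hlift⟩
    rw [intervalIntegral.integral_of_le hL.out.le] at h
    rw [← h]
    refine setIntegral_congr_fun measurableSet_Ioc fun x hx => ?_
    simp only [ContinuousMap.coe_mk, AddCircle.liftIoc_zero_coe_apply hx, Complex.ofReal_re]

omit hL in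
theorem HasWeakDeriv.integral_eq_zero {f g : AddCircle L → E} (h : HasWeakDeriv f g) :
    ∫ x in (0 : ℝ)..L, g (x : AddCircle L) = 0 := by
  have := h (fun _ => 1) contDiff_const (fun _ => rfl)
  simpa using this

/-- With `G` the primitive of `g`, the difference `f - G` has weak derivative zero and so is
constant. Testing against `ψ = 1` shows that `g` has mean zero, whence the representative closes up
at `L`. -/
theorem HasWeakDeriv.exists_isPrimitiveOn [CompleteSpace E] {f g : AddCircle L → E}
    (hf : Integrable f) (hg : Integrable g) (h : HasWeakDeriv f g) :
    ∃ F : ℝ → E, IsPrimitiveOn F (fun x : ℝ => g (x : AddCircle L)) 0 L ∧ F L = F 0 ∧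
      ∀ᵐ x : ℝ, x ∈ Set.Ioc 0 L → f (x : AddCircle L) = F x := by
  have hgi := hg.intervalIntegrable_coe
  have hfi := hf.intervalIntegrable_coe
  set G : ℝ → E := fun x => ∫ t in (0 : ℝ)..x, g (t : AddCircle L) with hG
  have hGp : IsPrimitiveOn G (fun x : ℝ => g (x : AddCircle L)) 0 L :=
    ⟨hgi, fun x _ => by simp [hG]⟩
  have hGi : IntervalIntegrable G volume 0 L := by
    refine ContinuousOn.intervalIntegrable ?_
    rw [Set.uIcc_of_le hL.out.le]
    exact hGp.continuousOn
  have hGL : G L = 0 := h.integral_eq_zero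
  have hG0 : G 0 = 0 := by simp [hG]
  obtain ⟨a, ha⟩ := exists_ae_eq_const_of_integral_deriv_smul_eq_zero
    (F := fun x => f (x : AddCircle L) - G x) (hfi.sub hGi) (by
      intro ψ hψ hper
      have hd : Continuous (deriv ψ) := hψ.continuous_deriv (by simp)
      have hψp : IsPrimitiveOn ψ (deriv ψ) 0 L := by
        refine ⟨hd.intervalIntegrable _ _, fun x _ => ?_⟩
        rw [intervalIntegral.integral_deriv_eq_sub
          (fun x _ => (hψ.differentiable (by simp)) x) (hd.intervalIntegrable _ _)]
        ring
      have hprod := hψp.bilinear (ContinuousLinearMap.lsmul ℝ ℝ) hL.out.le hGp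
      have h0 := hprod.sub_eq_integral (Set.left_mem_Icc.2 hL.out.le)
        (Set.right_mem_Icc.2 hL.out.le)
      simp only [ContinuousLinearMap.lsmul_apply, hGL, hG0, smul_zero, sub_zero] at h0
      rw [intervalIntegral.integral_add (hgi.continuousOn_smul hψ.continuous.continuousOn)
        (hGi.continuousOn_smul hd.continuousOn)] at h0
      simp only [smul_sub]
      rw [intervalIntegral.integral_sub (hfi.continuousOn_smul hd.continuousOn)
        (hGi.continuousOn_smul hd.continuousOn), h ψ hψ hper, ← neg_add', ← h0, neg_zero])
  refine ⟨fun x => a + G x, ⟨hgi, fun x hx => ?_⟩, by simp [hGL, hG0], ?_⟩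
  · simp only [hG0, add_zero]; rfl
  · filter_upwards [ha] with x hx hxI
    rw [← hx hxI]; abel

end Circle

/-! ### Sup-norm bounds and interpolation. -/

theorem MeasureTheory.integral_norm_mul_norm_le {α E F : Type*} [MeasurableSpace α] {μ : Measure α}
    [NormedAddCommGroup E] [NormedAddCommGroup F] {f : α → E} {g : α → F} (hf : MemLp f 2 μ)
    (hg : MemLp g 2 μ) {a b : ℝ} (ha : 0 ≤ a) (hb : 0 ≤ b) (hfa : ∫ x, ‖f x‖ ^ 2 ∂μ ≤ a ^ 2)
    (hgb : ∫ x, ‖g x‖ ^ 2 ∂μ ≤ b ^ 2) : ∫ x, ‖f x‖ * ‖g x‖ ∂μ ≤ a * b := by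
  have h2 : ENNReal.ofReal 2 = 2 := by norm_num
  have h := integral_mul_le_Lp_mul_Lq_of_nonneg (μ := μ) (p := 2) (q := 2)
    (Real.HolderConjugate.two_two) (f := fun x => ‖f x‖) (g := fun x => ‖g x‖)
    (Eventually.of_forall fun _ => norm_nonneg _) (Eventually.of_forall fun _ => norm_nonneg _)
    (by rw [h2]; exact hf.norm) (by rw [h2]; exact hg.norm)
  simp only [Real.rpow_two, ← Real.sqrt_eq_rpow] at h
  refine h.trans (mul_le_mul (Real.sqrt_le_iff.2 ⟨ha, hfa⟩) (Real.sqrt_le_iff.2 ⟨hb, hgb⟩)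
    (Real.sqrt_nonneg _) ha)

/-- Average `‖F x‖ ≤ ‖F t‖ + ∫ ‖f‖` over `t`. -/
theorem IsPrimitiveOn.norm_le {E : Type*} [NormedAddCommGroup E] [NormedSpace ℝ E] {F f : ℝ → E}
    {L : ℝ} (hL : 0 < L) (h : IsPrimitiveOn F f 0 L) {x : ℝ} (hx : x ∈ Set.Icc 0 L) :
    ‖F x‖ ≤ L⁻¹ * (∫ t in (0 : ℝ)..L, ‖F t‖) + ∫ t in (0 : ℝ)..L, ‖f t‖ := by
  set R := ∫ t in (0 : ℝ)..L, ‖f t‖ with hR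
  have hFi : IntervalIntegrable (fun t => ‖F t‖) volume 0 L := by
    refine ContinuousOn.intervalIntegrable ?_
    rw [Set.uIcc_of_le hL.le]
    exact h.continuousOn.norm
  have h1 : ∫ _t in (0 : ℝ)..L, ‖F x‖ ≤ ∫ t in (0 : ℝ)..L, (‖F t‖ + R) := by
    refine intervalIntegral.integral_mono_on hL.le intervalIntegrable_const
      (hFi.add intervalIntegrable_const) fun t ht => ?_
    have h2 := h.norm_sub_le_total ht hx
    have h3 := norm_le_norm_add_norm_sub' (F x) (F t)
    linarith
  rw [intervalIntegral.integral_add hFi intervalIntegrable_const, intervalIntegral.integral_const,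
    intervalIntegral.integral_const, sub_zero, smul_eq_mul, smul_eq_mul] at h1
  calc ‖F x‖ = L⁻¹ * (L * ‖F x‖) := by field_simp
    _ ≤ L⁻¹ * ((∫ t in (0 : ℝ)..L, ‖F t‖) + L * R) := by gcongr
    _ = _ := by field_simp

theorem IsPrimitiveOn.inner {E : Type*} [NormedAddCommGroup E] [InnerProductSpace ℝ E]
    [CompleteSpace E] {F f G g : ℝ → E} {a b : ℝ} (hab : a ≤ b) (hF : IsPrimitiveOn F f a b)
    (hG : IsPrimitiveOn G g a b) :
    IsPrimitiveOn (fun x => inner ℝ (F x) (G x))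
      (fun x => inner ℝ (F x) (g x) + inner ℝ (f x) (G x)) a b :=
  hF.bilinear (innerSL ℝ) hab hG

section Circle

variable {L : ℝ} [hL : Fact (0 < L)] {E : Type*} [NormedAddCommGroup E]

theorem intervalIntegral_norm_congr_of_ae [NormedSpace ℝ E] {α : Type*} {f : AddCircle L → E}
    {F : ℝ → E} (h : ∀ᵐ x : ℝ, x ∈ Set.Ioc 0 L → f (x : AddCircle L) = F x)
    [NormedAddCommGroup α] [NormedSpace ℝ α] (k : E → ℝ → α) :
    ∫ x in (0 : ℝ)..L, k (F x) x = ∫ x in (0 : ℝ)..L, k (f (x : AddCircle L)) x := by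
  refine intervalIntegral.integral_congr_ae ?_
  rw [Set.uIoc_of_le hL.out.le]
  filter_upwards [h] with x hx hxI
  rw [hx hxI]

theorem HasWeakDeriv.ae_norm_le [NormedSpace ℝ E] [CompleteSpace E] {f g : AddCircle L → E}
    (hf : Integrable f) (hg : Integrable g) (h : HasWeakDeriv f g) :
    ∀ᵐ x, ‖f x‖ ≤ L⁻¹ * (∫ y, ‖f y‖) + ∫ y, ‖g y‖ := by
  obtain ⟨F, hF, -, hfF⟩ := h.exists_isPrimitiveOn hf hg
  rw [AddCircle.ae_iff_ae_Ioc]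
  filter_upwards [hfF] with x hx hxI
  have h1 := hF.norm_le hL.out (Set.Ioc_subset_Icc_self hxI)
  rw [hx hxI, AddCircle.integral_eq_intervalIntegral, AddCircle.integral_eq_intervalIntegral]
  rwa [intervalIntegral_norm_congr_of_ae hfF (fun v _ => ‖v‖)] at h1

/-- A Gagliardo–Nirenberg interpolation inequality on the circle. -/
theorem ae_norm_sq_le_of_hasWeakDeriv [InnerProductSpace ℝ E] [CompleteSpace E]
    {u v w : AddCircle L → E} (hu : MemLp u 2) (hv : MemLp v 2) (hw : MemLp w 2)
    (huv : HasWeakDeriv u v) (hvw : HasWeakDeriv v w) {a b : ℝ} (ha : 0 ≤ a) (hb : 0 ≤ b)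
    (hua : ∫ x, ‖u x‖ ^ 2 ≤ a ^ 2) (hwb : ∫ x, ‖w x‖ ^ 2 ≤ b ^ 2) :
    ∀ᵐ x, ‖v x‖ ^ 2 ≤ L⁻¹ * (a * b) + 2 * (√(a * b) * b) := by
  have h12 : (1 : ℝ≥0∞) ≤ 2 := by norm_num
  obtain ⟨U, hU, hUL, huU⟩ := huv.exists_isPrimitiveOn (hu.integrable h12) (hv.integrable h12)
  obtain ⟨V, hV, hVL, hvV⟩ := hvw.exists_isPrimitiveOn (hv.integrable h12) (hw.integrable h12)
  have hle := hL.out.le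
  have huw : Integrable (fun x => ‖u x‖ * ‖w x‖) := hu.norm.integrable_mul hw.norm
  have hinner : Integrable (fun x => inner ℝ (u x) (w x)) :=
    huw.mono' (hu.1.inner hw.1) (Eventually.of_forall fun x => abs_real_inner_le_norm _ _)
  -- By periodicity the derivative of `⟨U, V⟩` has integral zero, so `∫ ‖v‖² = -∫ ⟨u, w⟩`.
  have hA : ∫ x, ‖v x‖ ^ 2 ≤ a * b := by
    have h1 := (hU.inner hle hV).sub_eq_integral (Set.left_mem_Icc.2 hle)
      (Set.right_mem_Icc.2 hle)
    rw [hUL, hVL, sub_self] at h1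
    have h2 : ∫ x in (0 : ℝ)..L, (inner ℝ (u (x : AddCircle L)) (w (x : AddCircle L))
        + ‖v (x : AddCircle L)‖ ^ 2) = 0 := by
      refine Eq.trans ?_ h1.symm
      refine intervalIntegral.integral_congr_ae ?_
      rw [Set.uIoc_of_le hle]
      filter_upwards [huU, hvV] with x h3 h4 hxI
      simp only [← h3 hxI, ← h4 hxI, real_inner_self_eq_norm_sq]
    rw [← AddCircle.integral_eq_intervalIntegral (fun x => inner ℝ (u x) (w x) + ‖v x‖ ^ 2),
      integral_add hinner ((memLp_two_iff_integrable_sq_norm hv.1).1 hv)] at h2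
    have h5 : -∫ x, inner ℝ (u x) (w x) ≤ ∫ x, ‖u x‖ * ‖w x‖ := by
      rw [← integral_neg]
      exact integral_mono hinner.neg huw fun x =>
        (neg_le_abs _).trans (abs_real_inner_le_norm _ _)
    have h6 := integral_norm_mul_norm_le hu hw ha hb hua hwb
    linarith
  -- The sup bound for primitives is now applied to `‖V‖²`, whose derivative is `2⟨V, w⟩`.
  have hQ := hV.inner hle hV
  have hB : ∫ x, ‖v x‖ * ‖w x‖ ≤ √(a * b) * b :=
    integral_norm_mul_norm_le hv hw (Real.sqrt_nonneg _) hb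
      (by rwa [Real.sq_sqrt (mul_nonneg ha hb)]) hwb
  rw [AddCircle.ae_iff_ae_Ioc]
  filter_upwards [hvV] with x hx hxI
  have h1 := hQ.norm_le hL.out (Set.Ioc_subset_Icc_self hxI)
  simp only [real_inner_self_eq_norm_sq] at h1
  rw [← hx hxI, norm_pow, norm_norm] at h1
  refine h1.trans (add_le_add ?_ ?_)
  · have := intervalIntegral_norm_congr_of_ae hvV (fun v _ => ‖‖v‖ ^ 2‖)
    rw [this, ← AddCircle.integral_eq_intervalIntegral (fun x => ‖‖v x‖ ^ 2‖)]
    simp only [norm_pow, norm_norm]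
    have := hL.out
    gcongr
  · have hvw' : Integrable (fun x => ‖v x‖ * ‖w x‖) := hv.norm.integrable_mul hw.norm
    calc _ ≤ ∫ x in (0 : ℝ)..L, 2 * (‖v (x : AddCircle L)‖ * ‖w (x : AddCircle L)‖) := by
          refine intervalIntegral.integral_mono_ae_restrict hle
            hQ.intervalIntegrable.norm (hvw'.intervalIntegrable_coe.const_mul 2) ?_
          have h₂ : ∀ᵐ x : ℝ, x ≠ 0 := by simp [ae_iff, measure_singleton]
          rw [EventuallyLE, ae_restrict_iff' measurableSet_Icc]
          filter_upwards [hvV, h₂] with y hy hy0 hyI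
          have hyI' : y ∈ Set.Ioc 0 L := ⟨lt_of_le_of_ne hyI.1 hy0.symm, hyI.2⟩
          rw [← hy hyI', real_inner_comm (v (y : AddCircle L)), ← two_mul, norm_mul, Real.norm_eq_abs,
            abs_two]
          exact mul_le_mul_of_nonneg_left (abs_real_inner_le_norm _ _) zero_le_two
      _ = 2 * ∫ x, ‖v x‖ * ‖w x‖ := by
          rw [intervalIntegral.integral_const_mul,
            ← AddCircle.integral_eq_intervalIntegral (fun x => ‖v x‖ * ‖w x‖)]
      _ ≤ _ := by gcongr

end Circle

/-! ### Pointwise inequalities for the duality map, the unit tangent and the curvature. -/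

section Pointwise

variable {E : Type*} [NormedAddCommGroup E] [InnerProductSpace ℝ E]

/-- Strong monotonicity of the duality map `a ↦ ‖a‖ ^ (p - 2) a`. -/
theorem norm_sub_rpow_le_inner {p : ℝ} (hp : 2 < p) (a b : E) :
    ‖a - b‖ ^ p ≤ 2 ^ (p - 1) * inner ℝ (‖a‖ ^ (p - 2) • a - ‖b‖ ^ (p - 2) • b) (a - b) := by
  set A := ‖a‖ ^ (p - 2) with hA
  set B := ‖b‖ ^ (p - 2) with hB
  have hp0 : 0 ≤ p - 2 := by linarith
  have hA0 : 0 ≤ A := by positivity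
  have hB0 : 0 ≤ B := by positivity
  have hsq : ‖a - b‖ ^ 2 = ‖a‖ ^ 2 - 2 * inner ℝ a b + ‖b‖ ^ 2 := norm_sub_sq_real a b
  have hin : inner ℝ (A • a - B • b) (a - b)
      = A * ‖a‖ ^ 2 - (A + B) * inner ℝ a b + B * ‖b‖ ^ 2 := by
    rw [inner_sub_left, inner_sub_right, inner_sub_right, inner_smul_left, inner_smul_left,
      inner_smul_left, inner_smul_left, real_inner_self_eq_norm_sq, real_inner_self_eq_norm_sq,
      real_inner_comm a b]
    simp only [conj_trivial]
    ring
  have hmono : 0 ≤ (A - B) * (‖a‖ ^ 2 - ‖b‖ ^ 2) := by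
    rcases le_total ‖a‖ ‖b‖ with h | h
    · refine mul_nonneg_of_nonpos_of_nonpos ?_ ?_
      · exact sub_nonpos.2 (Real.rpow_le_rpow (norm_nonneg _) h hp0)
      · exact sub_nonpos.2 (pow_le_pow_left₀ (norm_nonneg _) h 2)
    · refine mul_nonneg ?_ ?_
      · exact sub_nonneg.2 (Real.rpow_le_rpow (norm_nonneg _) h hp0)
      · exact sub_nonneg.2 (pow_le_pow_left₀ (norm_nonneg _) h 2)
  -- Twice the inner product equals `(A + B) ‖a - b‖² + (A - B)(‖a‖² - ‖b‖²)`, and the last term is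
  -- nonnegative by `hmono`.
  have h1 : (A + B) * ‖a - b‖ ^ 2 ≤ 2 * inner ℝ (A • a - B • b) (a - b) := by
    rw [hin, hsq]; nlinarith
  have h2 : ‖a - b‖ ^ (p - 2) ≤ 2 ^ (p - 2) * (A + B) := by
    have h3 : ‖a - b‖ ≤ 2 * max ‖a‖ ‖b‖ :=
      (norm_sub_le a b).trans (by linarith [le_max_left ‖a‖ ‖b‖, le_max_right ‖a‖ ‖b‖])
    refine (Real.rpow_le_rpow (norm_nonneg _) h3 hp0).trans ?_
    rw [Real.mul_rpow zero_le_two (le_max_of_le_left (norm_nonneg _))]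
    gcongr
    rcases max_choice ‖a‖ ‖b‖ with h | h <;> rw [h] <;> linarith
  have h3 : ‖a - b‖ ^ p = ‖a - b‖ ^ (p - 2) * ‖a - b‖ ^ 2 := by
    rw [← Real.rpow_natCast, ← Real.rpow_add' (norm_nonneg _) (by push_cast; linarith)]
    congr 1
    push_cast
    ring
  have h4 : (2 : ℝ) ^ (p - 1) = 2 ^ (p - 2) * 2 := by
    rw [← Real.rpow_add_one two_ne_zero]; congr 1; ring
  rw [h3, h4]
  calc _ ≤ 2 ^ (p - 2) * (A + B) * ‖a - b‖ ^ 2 := by gcongr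
    _ = 2 ^ (p - 2) * ((A + B) * ‖a - b‖ ^ 2) := by ring
    _ ≤ 2 ^ (p - 2) * (2 * inner ℝ (A • a - B • b) (a - b)) := by gcongr
    _ = _ := by ring

theorem norm_inv_norm_smul_le (v : E) : ‖‖v‖⁻¹ • v‖ ≤ 1 := by
  rw [norm_smul, norm_inv, norm_norm]
  exact inv_mul_le_one

theorem norm_inv_norm_smul_sub_le {c : ℝ} (hc : 0 < c) {v₁ v₂ : E} (h₁ : c ≤ ‖v₁‖)
    (h₂ : c ≤ ‖v₂‖) : ‖‖v₁‖⁻¹ • v₁ - ‖v₂‖⁻¹ • v₂‖ ≤ 2 / c * ‖v₁ - v₂‖ := by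
  have hv₁ : 0 < ‖v₁‖ := hc.trans_le h₁
  have hv₂ : 0 < ‖v₂‖ := hc.trans_le h₂
  have e : ‖v₁‖⁻¹ • v₁ - ‖v₂‖⁻¹ • v₂
      = ‖v₁‖⁻¹ • (v₁ - v₂) + (‖v₁‖⁻¹ * (‖v₂‖ - ‖v₁‖)) • (‖v₂‖⁻¹ • v₂) := by
    rw [smul_smul, show ‖v₁‖⁻¹ * (‖v₂‖ - ‖v₁‖) * ‖v₂‖⁻¹ = ‖v₁‖⁻¹ - ‖v₂‖⁻¹ by field_simp]
    module
  have hi : ‖v₁‖⁻¹ ≤ c⁻¹ := inv_anti₀ hc h₁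
  rw [e]
  calc _ ≤ ‖‖v₁‖⁻¹ • (v₁ - v₂)‖ + ‖(‖v₁‖⁻¹ * (‖v₂‖ - ‖v₁‖)) • (‖v₂‖⁻¹ • v₂)‖ := norm_add_le _ _
    _ ≤ c⁻¹ * ‖v₁ - v₂‖ + c⁻¹ * ‖v₁ - v₂‖ * 1 := by
      rw [norm_smul, norm_smul, norm_mul, norm_inv, norm_norm]
      gcongr
      · rw [norm_sub_rev]; exact abs_norm_sub_norm_le v₁ v₂
      · exact norm_inv_norm_smul_le v₂
    _ = _ := by ring

/-- The derivative of `v ↦ v / ‖v‖`. -/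
noncomputable def unitDeriv (v : E) : E →L[ℝ] E :=
  ‖v‖⁻¹ • (ContinuousLinearMap.id ℝ E - (innerSL ℝ (‖v‖⁻¹ • v)).smulRight (‖v‖⁻¹ • v))

theorem unitDeriv_apply (v w : E) : unitDeriv v w = ‖v‖⁻¹ • normalProj v w := by
  simp only [unitDeriv, normalProj, _root_.smul_apply, _root_.sub_apply,
    ContinuousLinearMap.id_apply, ContinuousLinearMap.smulRight_apply, innerSL_apply_apply]
  rw [real_inner_comm]

theorem hasFDerivAt_inv_norm_smul {v : E} (hv : v ≠ 0) :
    HasFDerivAt (fun v : E => ‖v‖⁻¹ • v) (unitDeriv v) v := by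
  have hn : ‖v‖ ≠ 0 := norm_ne_zero_iff.2 hv
  have h1 := (hasStrictFDerivAt_norm_sq v).hasFDerivAt.sqrt (pow_ne_zero 2 hn)
  have h2 := ((hasDerivAt_inv (by simpa using hn)).comp_hasFDerivAt v h1).smul (hasFDerivAt_id v)
  simp only [Real.sqrt_sq (norm_nonneg _)] at h2
  have h3 := h2.congr_of_eventuallyEq (f₁ := fun v : E => ‖v‖⁻¹ • v)
    (Eventually.of_forall fun x => by simp)
  refine h3.congr_fderiv ?_
  ext w
  rw [unitDeriv_apply, normalProj]
  simp [inner_smul_right, smul_smul, smul_sub, real_inner_comm w v]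
  rw [sub_eq_add_neg]
  congr 3
  ring

theorem normalProj_sub (v w₁ w₂ : E) :
    normalProj v w₁ - normalProj v w₂ = normalProj v (w₁ - w₂) := by
  simp only [normalProj, inner_sub_left, sub_smul]; abel

theorem norm_inner_smul_le {e w f : E} (he : ‖e‖ ≤ 1) : ‖inner ℝ w e • f‖ ≤ ‖w‖ * ‖f‖ := by
  rw [norm_smul]
  gcongr
  exact (norm_inner_le_norm w e).trans (mul_le_of_le_one_right (norm_nonneg _) he)

theorem norm_normalProj_le (v w : E) : ‖normalProj v w‖ ≤ 2 * ‖w‖ := by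
  have h1 := norm_inner_smul_le (w := w) (f := ‖v‖⁻¹ • v) (norm_inv_norm_smul_le v)
  have h2 : ‖w‖ * ‖‖v‖⁻¹ • v‖ ≤ ‖w‖ := mul_le_of_le_one_right (norm_nonneg _) (norm_inv_norm_smul_le v)
  refine (norm_sub_le _ _).trans ?_
  linarith

theorem norm_normalProj_sub_le {c : ℝ} (hc : 0 < c) {v₁ v₂ : E} (w : E) (h₁ : c ≤ ‖v₁‖)
    (h₂ : c ≤ ‖v₂‖) : ‖normalProj v₁ w - normalProj v₂ w‖ ≤ 4 / c * ‖v₁ - v₂‖ * ‖w‖ := by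
  set e := ‖v₁‖⁻¹ • v₁ with he
  set f := ‖v₂‖⁻¹ • v₂ with hf
  have hef : ‖e - f‖ ≤ 2 / c * ‖v₁ - v₂‖ := norm_inv_norm_smul_sub_le hc h₁ h₂
  have heq : normalProj v₁ w - normalProj v₂ w = -(inner ℝ w e • (e - f) + inner ℝ w (e - f) • f) := by
    rw [normalProj, normalProj, ← he, ← hf, inner_sub_right]; module
  rw [heq, norm_neg]
  have h3 : ‖inner ℝ w (e - f) • f‖ ≤ ‖w‖ * ‖e - f‖ := by
    rw [norm_smul]
    exact (mul_le_of_le_one_right (norm_nonneg _) (norm_inv_norm_smul_le v₂)).trans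
      (norm_inner_le_norm w _)
  calc _ ≤ ‖w‖ * ‖e - f‖ + ‖w‖ * ‖e - f‖ :=
        (norm_add_le _ _).trans (add_le_add (norm_inner_smul_le (norm_inv_norm_smul_le v₁)) h3)
    _ ≤ ‖w‖ * (2 / c * ‖v₁ - v₂‖) + ‖w‖ * (2 / c * ‖v₁ - v₂‖) := by gcongr
    _ = _ := by ring

/-- The curvature of a curve with velocity `v` and acceleration `w`. -/
noncomputable def curvatureOf (v w : E) : E := (‖v‖ ^ 2)⁻¹ • normalProj v w

theorem norm_curvatureOf_le {c : ℝ} (hc : 0 < c) {v : E} (w : E) (h : c ≤ ‖v‖) :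
    ‖curvatureOf v w‖ ≤ 2 / c ^ 2 * ‖w‖ := by
  rw [curvatureOf, norm_smul, norm_inv, norm_pow, norm_norm]
  calc _ ≤ (c ^ 2)⁻¹ * (2 * ‖w‖) := by
        gcongr
        exact norm_normalProj_le v w
    _ = _ := by ring

/-- Up to the factor `‖γ'‖` the curvature is the `x`-derivative of the unit tangent; this is what
permits integration by parts. -/
theorem norm_smul_curvatureOf {v : E} (hv : v ≠ 0) (w : E) :
    ‖v‖ • curvatureOf v w = unitDeriv v w := by
  have hn : ‖v‖ ≠ 0 := norm_ne_zero_iff.2 hv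
  rw [curvatureOf, unitDeriv_apply, smul_smul]
  congr 1
  field_simp

/-- Telescoping over the projection, the factor `‖v‖⁻²` and the acceleration. It serves the
continuity of the curvature map, hence measurability in time, and not the compactness estimate. -/
theorem norm_curvatureOf_sub_le {c : ℝ} (hc : 0 < c) {v₁ v₂ : E} (w₁ w₂ : E) (h₁ : c ≤ ‖v₁‖)
    (h₂ : c ≤ ‖v₂‖) : ‖curvatureOf v₁ w₁ - curvatureOf v₂ w₂‖
      ≤ 8 / c ^ 3 * ‖v₁ - v₂‖ * ‖w₁‖ + 2 / c ^ 2 * ‖w₁ - w₂‖ := by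
  have hv₁ : 0 < ‖v₁‖ := hc.trans_le h₁
  have hv₂ : 0 < ‖v₂‖ := hc.trans_le h₂
  have e : curvatureOf v₁ w₁ - curvatureOf v₂ w₂
      = (‖v₁‖ ^ 2)⁻¹ • (normalProj v₁ w₁ - normalProj v₂ w₁)
        + ((‖v₁‖ ^ 2)⁻¹ - (‖v₂‖ ^ 2)⁻¹) • normalProj v₂ w₁ + curvatureOf v₂ (w₁ - w₂) := by
    simp only [curvatureOf, ← normalProj_sub]; module
  have hi : |(‖v₁‖ ^ 2)⁻¹ - (‖v₂‖ ^ 2)⁻¹| ≤ 2 / c ^ 3 * ‖v₁ - v₂‖ := by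
    have e2 : (‖v₁‖ ^ 2)⁻¹ - (‖v₂‖ ^ 2)⁻¹
        = (‖v₁‖⁻¹ * (‖v₂‖ ^ 2)⁻¹ + (‖v₁‖ ^ 2)⁻¹ * ‖v₂‖⁻¹) * (‖v₂‖ - ‖v₁‖) := by
      field_simp; ring
    rw [e2, abs_mul, abs_of_nonneg (by positivity), norm_sub_rev v₁ v₂]
    calc _ ≤ (c⁻¹ * (c ^ 2)⁻¹ + (c ^ 2)⁻¹ * c⁻¹) * ‖v₂ - v₁‖ := by
          gcongr
          exact abs_norm_sub_norm_le v₂ v₁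
      _ = _ := by field_simp; ring
  rw [e]
  refine (norm_add_le _ _).trans (add_le_add ?_ (norm_curvatureOf_le hc _ h₂))
  refine (norm_add_le _ _).trans ?_
  rw [norm_smul, norm_smul, norm_inv, norm_pow, norm_norm, Real.norm_eq_abs]
  calc _ ≤ (c ^ 2)⁻¹ * (4 / c * ‖v₁ - v₂‖ * ‖w₁‖) + 2 / c ^ 3 * ‖v₁ - v₂‖ * (2 * ‖w₁‖) := by
        gcongr
        · exact norm_normalProj_sub_le hc w₁ h₁ h₂
        · exact norm_normalProj_le _ _
    _ = _ := by field_simp; ring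

theorem MeasureTheory.AEStronglyMeasurable.normalProj {α : Type*} [MeasurableSpace α]
    {μ : Measure α} {v w : α → E} (hv : AEStronglyMeasurable v μ) (hw : AEStronglyMeasurable w μ) :
    AEStronglyMeasurable (fun x => normalProj (v x) (w x)) μ := by
  have he : AEStronglyMeasurable (fun x => ‖v x‖⁻¹ • v x) μ :=
    hv.norm.aemeasurable.inv.aestronglyMeasurable.smul hv
  exact hw.sub ((hw.inner he).smul he)

theorem MeasureTheory.AEStronglyMeasurable.curvatureOf {α : Type*} [MeasurableSpace α]
    {μ : Measure α} {v w : α → E} (hv : AEStronglyMeasurable v μ) (hw : AEStronglyMeasurable w μ) :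
    AEStronglyMeasurable (fun x => curvatureOf (v x) (w x)) μ :=
  (hv.norm.aemeasurable.pow_const 2).inv.aestronglyMeasurable.smul (hv.normalProj hw)

end Pointwise

/-! ### The stability estimate for two regular curves. -/

theorem ContinuousOn.le_of_ae_le {f : ℝ → ℝ} {a b c : ℝ} (hab : a < b)
    (hf : ContinuousOn f (Set.Icc a b)) (h : ∀ᵐ x, x ∈ Set.Ioc a b → c ≤ f x) :
    ∀ x ∈ Set.Icc a b, c ≤ f x := by
  have h₂ : ∀ᵐ x : ℝ, x ≠ a := by simp [ae_iff, measure_singleton]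
  -- The inequality is encoded as the equality `max (c - f) 0 = 0`, which continuous functions
  -- inherit from almost everywhere.
  have key : Set.EqOn (fun x => max (c - f x) 0) (fun _ => 0) (Set.Icc a b) := by
    refine Measure.eqOn_Icc_of_ae_eq volume hab.ne ?_
      ((continuousOn_const.sub hf).sup continuousOn_const) continuousOn_const
    rw [EventuallyEq, ae_restrict_iff' measurableSet_Icc]
    filter_upwards [h, h₂] with x hx hxa hxI
    exact max_eq_right (sub_nonpos.2 (hx ⟨lt_of_le_of_ne hxI.1 hxa.symm, hxI.2⟩))
  intro x hx
  have := key hx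
  simp only [max_eq_right_iff] at this
  linarith

theorem IsPrimitiveOn.inv_norm_smul {E : Type*} [NormedAddCommGroup E] [InnerProductSpace ℝ E]
    [CompleteSpace E] {V w : ℝ → E} {a b c : ℝ} (hab : a ≤ b) (hc : 0 < c)
    (hV : IsPrimitiveOn V w a b) (hreg : ∀ x ∈ Set.Icc a b, c ≤ ‖V x‖) :
    IsPrimitiveOn (fun x => ‖V x‖⁻¹ • V x) (fun x => unitDeriv (V x) (w x)) a b := by
  refine hV.comp_lipschitz (φ := fun v => ‖v‖⁻¹ • v) (K := 2 / c) hab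
    (fun x hx y hy => norm_inv_norm_smul_sub_le hc (hreg y hy) (hreg x hx)) (by positivity)
    (fun x hx => hasFDerivAt_inv_norm_smul (norm_pos_iff.1 (hc.trans_le (hreg x hx)))) ?_
  simp only [unitDeriv_apply]
  have hVm : AEStronglyMeasurable V (volume.restrict (Set.Ioc a b)) :=
    (hV.continuousOn.mono Set.Ioc_subset_Icc_self).aestronglyMeasurable measurableSet_Ioc
  have hwi := (intervalIntegrable_iff_integrableOn_Ioc_of_le hab).1 hV.intervalIntegrable
  rw [intervalIntegrable_iff_integrableOn_Ioc_of_le hab]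
  refine (hwi.norm.const_mul (c⁻¹ * 2)).mono'
    (hVm.norm.aemeasurable.inv.aestronglyMeasurable.smul
      (hVm.normalProj hwi.aestronglyMeasurable)) ?_
  filter_upwards [ae_restrict_mem measurableSet_Ioc] with x hx
  rw [norm_smul, norm_inv, norm_norm, mul_assoc]
  have := inv_anti₀ hc (hreg x (Set.Ioc_subset_Icc_self hx))
  gcongr
  exact norm_normalProj_le _ _

/-- The difference of the curvatures of two uniformly regular curves is controlled by the
`C¹`-distance of the curves and the `W^{1,1}`-norms of `‖κ‖ ^ (p - 2) κ`. -/
theorem integral_curvatureOf_sub_rpow_le {L : ℝ} [hL : Fact (0 < L)] {E : Type*}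
    [NormedAddCommGroup E] [InnerProductSpace ℝ E] [CompleteSpace E] {p c δ : ℝ} (hp : 2 < p)
    (hc : 0 < c) (hδ : 0 ≤ δ) {v₁ w₁ v₂ w₂ h₁ g₁ h₂ g₂ : AddCircle L → E}
    (hv₁ : Integrable v₁) (hw₁ : Integrable w₁) (hv₂ : Integrable v₂) (hw₂ : Integrable w₂)
    (hh₁ : Integrable h₁) (hg₁ : Integrable g₁) (hh₂ : Integrable h₂) (hg₂ : Integrable g₂)
    (hvw₁ : HasWeakDeriv v₁ w₁) (hvw₂ : HasWeakDeriv v₂ w₂)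
    (hhg₁ : HasWeakDeriv h₁ g₁) (hhg₂ : HasWeakDeriv h₂ g₂)
    (hc₁ : ∀ᵐ x, c ≤ ‖v₁ x‖) (hc₂ : ∀ᵐ x, c ≤ ‖v₂ x‖) (hvδ : ∀ᵐ x, ‖v₁ x - v₂ x‖ ≤ δ)
    (hκ₁ : ∀ᵐ x, h₁ x = ‖curvatureOf (v₁ x) (w₁ x)‖ ^ (p - 2) • curvatureOf (v₁ x) (w₁ x))
    (hκ₂ : ∀ᵐ x, h₂ x = ‖curvatureOf (v₂ x) (w₂ x)‖ ^ (p - 2) • curvatureOf (v₂ x) (w₂ x)) :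
    c * ∫ x, ‖curvatureOf (v₁ x) (w₁ x) - curvatureOf (v₂ x) (w₂ x)‖ ^ p
      ≤ 2 ^ (p - 1) * (2 / c * δ * (∫ x, ‖g₁ x - g₂ x‖)
        + (L⁻¹ * (∫ x, ‖h₁ x - h₂ x‖) + ∫ x, ‖g₁ x - g₂ x‖) * δ
          * (2 / c ^ 2) * ∫ x, ‖w₂ x‖) := by
  have hle := hL.out.le
  obtain ⟨V₁, hV₁, hVL₁, hvV₁⟩ := hvw₁.exists_isPrimitiveOn hv₁ hw₁
  obtain ⟨V₂, hV₂, hVL₂, hvV₂⟩ := hvw₂.exists_isPrimitiveOn hv₂ hw₂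
  obtain ⟨H₁, hH₁, hHL₁, hhH₁⟩ := hhg₁.exists_isPrimitiveOn hh₁ hg₁
  obtain ⟨H₂, hH₂, hHL₂, hhH₂⟩ := hhg₂.exists_isPrimitiveOn hh₂ hg₂
  rw [AddCircle.ae_iff_ae_Ioc] at hc₁ hc₂ hvδ hκ₁ hκ₂
  have hreg : ∀ {v : AddCircle L → E} {V w : ℝ → E}, IsPrimitiveOn V w 0 L →
      (∀ᵐ x : ℝ, x ∈ Set.Ioc 0 L → v (x : AddCircle L) = V x) →
      (∀ᵐ x : ℝ, x ∈ Set.Ioc 0 L → c ≤ ‖v (x : AddCircle L)‖) →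
      ∀ x ∈ Set.Icc 0 L, c ≤ ‖V x‖ := by
    intro v V w hV hvV hcv
    refine hV.continuousOn.norm.le_of_ae_le hL.out ?_
    filter_upwards [hvV, hcv] with x h1 h2 hx
    rw [← h1 hx]; exact h2 hx
  have hT₁ := hV₁.inv_norm_smul hle hc (hreg hV₁ hvV₁ hc₁)
  have hT₂ := hV₂.inv_norm_smul hle hc (hreg hV₂ hvV₂ hc₂)
  have hT := hT₁.sub hT₂
  have hH := hH₁.sub hH₂
  -- The pairing of `H₁ - H₂` with the difference of the unit tangents takes equal values at `0` and
  -- `L`, so its derivative integrates to zero: integration by parts without boundary terms.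
  have hP := hH.inner hle hT
  have hP0 := hP.sub_eq_integral (Set.left_mem_Icc.2 hle) (Set.right_mem_Icc.2 hle)
  simp only [hVL₁, hVL₂, hHL₁, hHL₂, sub_self] at hP0
  set S := L⁻¹ * (∫ x, ‖h₁ x - h₂ x‖) + ∫ x, ‖g₁ x - g₂ x‖ with hS
  have hHb : ∀ x ∈ Set.Icc 0 L, ‖H₁ x - H₂ x‖ ≤ S := by
    intro x hx
    refine (hH.norm_le hL.out hx).trans_eq ?_
    rw [hS, AddCircle.integral_eq_intervalIntegral, AddCircle.integral_eq_intervalIntegral]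
    congr 2
    refine intervalIntegral.integral_congr_ae ?_
    rw [Set.uIoc_of_le hle]
    filter_upwards [hhH₁, hhH₂] with x h1 h2 hxI
    rw [h1 hxI, h2 hxI]
  have hS0 : 0 ≤ S := (norm_nonneg _).trans (hHb 0 (Set.left_mem_Icc.2 hle))
  have hgi : IntervalIntegrable
      (fun x : ℝ => ‖g₁ (x : AddCircle L) - g₂ (x : AddCircle L)‖) volume 0 L :=
    (hg₁.sub hg₂).norm.intervalIntegrable_coe
  have hwi := hw₂.norm.intervalIntegrable_coe
  -- On the right, the inner bracket is the full derivative of that pairing and will drop out; the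
  -- other two terms are the errors that survive.
  have hmono : ∫ x in (0 : ℝ)..L, c * ‖curvatureOf (v₁ (x : AddCircle L)) (w₁ (x : AddCircle L))
        - curvatureOf (v₂ (x : AddCircle L)) (w₂ (x : AddCircle L))‖ ^ p
      ≤ ∫ x in (0 : ℝ)..L, 2 ^ (p - 1) * ((inner ℝ (H₁ x - H₂ x)
            (unitDeriv (V₁ x) (w₁ (x : AddCircle L)) - unitDeriv (V₂ x) (w₂ (x : AddCircle L)))
          + inner ℝ (g₁ (x : AddCircle L) - g₂ (x : AddCircle L))
            (‖V₁ x‖⁻¹ • V₁ x - ‖V₂ x‖⁻¹ • V₂ x))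
        + (2 / c * δ * ‖g₁ (x : AddCircle L) - g₂ (x : AddCircle L)‖
          + S * δ * (2 / c ^ 2) * ‖w₂ (x : AddCircle L)‖)) := by
    rw [intervalIntegral.integral_of_le hle, intervalIntegral.integral_of_le hle]
    refine integral_mono_of_nonneg (Eventually.of_forall fun x => by positivity)
      ((intervalIntegrable_iff_integrableOn_Ioc_of_le hle).1
        ((hP.intervalIntegrable.add ((hgi.const_mul _).add (hwi.const_mul _))).const_mul _)) ?_
    rw [EventuallyLE, ae_restrict_iff' measurableSet_Ioc]
    filter_upwards [hvV₁, hvV₂, hhH₁, hhH₂, hc₁, hc₂, hvδ, hκ₁, hκ₂]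
      with x e1 e2 e3 e4 e5 e6 e7 e8 e9 hxI
    have hHx := hHb x (Set.Ioc_subset_Icc_self hxI)
    rw [← e1 hxI, ← e2 hxI, ← e3 hxI, ← e4 hxI]
    rw [← e3 hxI, ← e4 hxI] at hHx
    specialize e5 hxI
    specialize e6 hxI
    specialize e7 hxI
    specialize e8 hxI
    specialize e9 hxI
    generalize v₁ (x : AddCircle L) = a₁ at *
    generalize v₂ (x : AddCircle L) = a₂ at *
    generalize w₁ (x : AddCircle L) = b₁ at *
    generalize w₂ (x : AddCircle L) = b₂ at *
    generalize h₁ (x : AddCircle L) = k₁ at *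
    generalize h₂ (x : AddCircle L) = k₂ at *
    generalize g₁ (x : AddCircle L) - g₂ (x : AddCircle L) = g at *
    have hn₁ : a₁ ≠ 0 := norm_pos_iff.1 (hc.trans_le e5)
    have hn₂ : a₂ ≠ 0 := norm_pos_iff.1 (hc.trans_le e6)
    have hm := norm_sub_rpow_le_inner hp (curvatureOf a₁ b₁) (curvatureOf a₂ b₂)
    rw [← e8, ← e9] at hm
    -- Only one weight, `‖a₁‖`, is available, so `κ₂` acquires the mismatch `‖a₂‖ - ‖a₁‖`.
    have hin : ‖a₁‖ * inner ℝ (k₁ - k₂) (curvatureOf a₁ b₁ - curvatureOf a₂ b₂)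
        = inner ℝ (k₁ - k₂) (unitDeriv a₁ b₁ - unitDeriv a₂ b₂)
          + (‖a₂‖ - ‖a₁‖) * inner ℝ (k₁ - k₂) (curvatureOf a₂ b₂) := by
      rw [← norm_smul_curvatureOf hn₁, ← norm_smul_curvatureOf hn₂]
      simp only [inner_sub_right, real_inner_smul_right]
      ring
    have hlow : (‖a₂‖ - ‖a₁‖) * inner ℝ (k₁ - k₂) (curvatureOf a₂ b₂)
        ≤ S * δ * (2 / c ^ 2) * ‖b₂‖ := by
      calc _ ≤ |(‖a₂‖ - ‖a₁‖) * inner ℝ (k₁ - k₂) (curvatureOf a₂ b₂)| := le_abs_self _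
        _ ≤ δ * (S * (2 / c ^ 2 * ‖b₂‖)) := by
          rw [abs_mul]
          gcongr
          · exact (abs_norm_sub_norm_le a₂ a₁).trans (by rwa [norm_sub_rev])
          · refine (abs_real_inner_le_norm _ _).trans ?_
            gcongr
            exact norm_curvatureOf_le hc b₂ e6
        _ = _ := by ring
    -- The price of adding the `g`-term that completes the derivative of the pairing.
    have hpart : -inner ℝ g (‖a₁‖⁻¹ • a₁ - ‖a₂‖⁻¹ • a₂) ≤ 2 / c * δ * ‖g‖ := by
      calc _ ≤ ‖g‖ * ‖‖a₁‖⁻¹ • a₁ - ‖a₂‖⁻¹ • a₂‖ :=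
            (neg_le_abs _).trans (abs_real_inner_le_norm _ _)
        _ ≤ ‖g‖ * (2 / c * δ) := by
          gcongr
          exact (norm_inv_norm_smul_sub_le hc e5 e6).trans (by gcongr)
        _ = _ := by ring
    calc c * ‖curvatureOf a₁ b₁ - curvatureOf a₂ b₂‖ ^ p
        ≤ ‖a₁‖ * ‖curvatureOf a₁ b₁ - curvatureOf a₂ b₂‖ ^ p := by gcongr
      _ ≤ ‖a₁‖ * (2 ^ (p - 1) * inner ℝ (k₁ - k₂) (curvatureOf a₁ b₁ - curvatureOf a₂ b₂)) := by
          gcongr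
      _ = 2 ^ (p - 1) * (inner ℝ (k₁ - k₂) (unitDeriv a₁ b₁ - unitDeriv a₂ b₂)
          + (‖a₂‖ - ‖a₁‖) * inner ℝ (k₁ - k₂) (curvatureOf a₂ b₂)) := by rw [← hin]; ring
      _ ≤ _ := by
          refine mul_le_mul_of_nonneg_left ?_ (by positivity)
          linarith
  rw [intervalIntegral.integral_const_mul, intervalIntegral.integral_const_mul,
    intervalIntegral.integral_add hP.intervalIntegrable
      ((hgi.const_mul _).add (hwi.const_mul _)), ← hP0, zero_add,
    intervalIntegral.integral_add (hgi.const_mul _) (hwi.const_mul _),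
    intervalIntegral.integral_const_mul, intervalIntegral.integral_const_mul] at hmono
  rw [AddCircle.integral_eq_intervalIntegral, AddCircle.integral_eq_intervalIntegral (fun x => ‖w₂ x‖),
    AddCircle.integral_eq_intervalIntegral (fun x => ‖g₁ x - g₂ x‖)]
  exact hmono

/-! ### Norm comparisons, `C¹` control and continuity of the curvature map. -/

section Norms

variable {α E : Type*} [MeasurableSpace α] {μ : Measure α} [NormedAddCommGroup E]

theorem MeasureTheory.MemLp.integral_norm_rpow_eq {f : α → E} {r : ℝ} (hr : 0 < r)
    (hf : MemLp f (ENNReal.ofReal r) μ) :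
    ∫ x, ‖f x‖ ^ r ∂μ = (eLpNorm f (ENNReal.ofReal r) μ).toReal ^ r := by
  have h0 : 0 ≤ ∫ x, ‖f x‖ ^ r ∂μ := integral_nonneg fun x => by positivity
  rw [hf.eLpNorm_eq_integral_rpow_norm (by simpa using hr) ENNReal.ofReal_ne_top,
    ENNReal.toReal_ofReal hr.le, ENNReal.toReal_ofReal (by positivity), Real.rpow_inv_rpow h0 hr.ne']

theorem MeasureTheory.Lp.exists_eLpNorm_le [IsFiniteMeasure μ] (E : Type*) [NormedAddCommGroup E]
    {r q : ℝ≥0∞} (hrq : r ≤ q) :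
    ∃ K, 0 ≤ K ∧ ∀ f : Lp E q μ, (eLpNorm f r μ).toReal ≤ K * ‖f‖ := by
  by_cases hr : r = 0
  · exact ⟨0, le_rfl, fun f => by simp [hr]⟩
  refine ⟨(μ Set.univ ^ (1 / r.toReal - 1 / q.toReal)).toReal, ENNReal.toReal_nonneg, fun f => ?_⟩
  have hexp : 0 ≤ 1 / r.toReal - 1 / q.toReal := by
    rw [one_div, one_div, ← ENNReal.toReal_inv, ← ENNReal.toReal_inv]
    exact sub_nonneg.2 (ENNReal.toReal_mono (ENNReal.inv_ne_top.2 hr) (ENNReal.inv_le_inv.2 hrq))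
  rw [Lp.norm_def, ← ENNReal.toReal_mul, mul_comm]
  exact ENNReal.toReal_mono (ENNReal.mul_ne_top (Lp.eLpNorm_ne_top f)
    (ENNReal.rpow_ne_top_of_nonneg hexp (measure_ne_top _ _)))
    (eLpNorm_le_eLpNorm_mul_rpow_measure_univ hrq (Lp.aestronglyMeasurable f))

theorem MeasureTheory.Lp.exists_integral_norm_le [IsFiniteMeasure μ] (E : Type*)
    [NormedAddCommGroup E] {q : ℝ≥0∞} (hq : 1 ≤ q) :
    ∃ K, 0 ≤ K ∧ ∀ f : Lp E q μ, ∫ x, ‖f x‖ ∂μ ≤ K * ‖f‖ := by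
  obtain ⟨K, hK0, hK⟩ := Lp.exists_eLpNorm_le (μ := μ) E hq
  refine ⟨K, hK0, fun f => ?_⟩
  have h1 : ENNReal.ofReal 1 = 1 := by simp
  have h := MemLp.integral_norm_rpow_eq (f := f) (μ := μ) (r := 1) zero_lt_one
    (by rw [h1]; exact (Lp.memLp f).mono_exponent hq)
  simp only [Real.rpow_one, h1] at h
  rw [h]
  exact hK f

theorem MeasureTheory.integral_norm_sq_eq {f : α → E} (hf : MemLp f 2 μ) :
    ∫ x, ‖f x‖ ^ 2 ∂μ = (eLpNorm f 2 μ).toReal ^ 2 := by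
  have h2 : ENNReal.ofReal 2 = 2 := by norm_num
  have h := MemLp.integral_norm_rpow_eq (f := f) (μ := μ) (r := 2) zero_lt_two (by rwa [h2])
  simpa only [Real.rpow_two, h2] using h

end Norms

section Curves

variable {L : ℝ} [hL : Fact (0 < L)] {E : Type*} [NormedAddCommGroup E] [InnerProductSpace ℝ E]
  {q : ℝ≥0∞} [hq : Fact (1 ≤ q)]

namespace SobolevTwo

theorem norm_fst_le (u : SobolevTwo L E q) : ‖u.1.1‖ ≤ ‖u‖ := _root_.norm_fst_le u.1

theorem norm_snd_fst_le (u : SobolevTwo L E q) : ‖u.1.2.1‖ ≤ ‖u‖ :=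
  (_root_.norm_fst_le u.1.2).trans (norm_snd_le u.1)

theorem norm_snd_snd_le (u : SobolevTwo L E q) : ‖u.1.2.2‖ ≤ ‖u‖ :=
  (norm_snd_le u.1.2).trans (norm_snd_le u.1)

theorem memLp_toFun (u : SobolevTwo L E q) : MemLp (toFun u) q := Lp.memLp u.1.1

theorem memLp_d1 (u : SobolevTwo L E q) : MemLp (d1 u) q := Lp.memLp u.1.2.1

theorem memLp_d2 (u : SobolevTwo L E q) : MemLp (d2 u) q := Lp.memLp u.1.2.2

theorem hasWeakDeriv_toFun (u : SobolevTwo L E q) : HasWeakDeriv (toFun u) (d1 u) := u.2.1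

theorem hasWeakDeriv_d1 (u : SobolevTwo L E q) : HasWeakDeriv (d1 u) (d2 u) := u.2.2

theorem toFun_sub_ae (u v : SobolevTwo L E q) :
    toFun (u - v) =ᵐ[volume] fun x => toFun u x - toFun v x := Lp.coeFn_sub u.1.1 v.1.1

theorem d1_sub_ae (u v : SobolevTwo L E q) :
    d1 (u - v) =ᵐ[volume] fun x => d1 u x - d1 v x := Lp.coeFn_sub u.1.2.1 v.1.2.1

theorem d2_sub_ae (u v : SobolevTwo L E q) :
    d2 (u - v) =ᵐ[volume] fun x => d2 u x - d2 v x := Lp.coeFn_sub u.1.2.2 v.1.2.2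

variable (L E q) in
theorem exists_ae_norm_d1_le [CompleteSpace E] :
    ∃ K, 0 ≤ K ∧ ∀ u : SobolevTwo L E q, ∀ᵐ x, ‖d1 u x‖ ≤ K * ‖u‖ := by
  obtain ⟨K, hK0, hK⟩ := Lp.exists_integral_norm_le (μ := (volume : Measure (AddCircle L))) E hq.out
  have := hL.out
  refine ⟨L⁻¹ * K + K, by positivity, fun u => ?_⟩
  filter_upwards [(SobolevTwo.hasWeakDeriv_d1 u).ae_norm_le
    ((SobolevTwo.memLp_d1 u).integrable hq.out)
    ((SobolevTwo.memLp_d2 u).integrable hq.out)] with x hx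
  refine hx.trans ?_
  rw [add_mul, mul_assoc]
  gcongr
  · exact (hK u.1.2.1).trans (by gcongr; exact (SobolevTwo.norm_snd_fst_le u))
  · exact (hK u.1.2.2).trans (by gcongr; exact (SobolevTwo.norm_snd_snd_le u))

/-- On bounded subsets of `W^{2,q}`, closeness in `L²` implies closeness in `C¹`. -/
theorem exists_ae_norm_d1_le_of_eLpNorm_le [CompleteSpace E] (hq2 : 2 ≤ q) (M : ℝ) {ε : ℝ}
    (hε : 0 < ε) : ∃ η, 0 < η ∧ ∀ u : SobolevTwo L E q, ‖u‖ ≤ M →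
      eLpNorm (toFun u) 2 volume ≤ ENNReal.ofReal η → ∀ᵐ x, ‖d1 u x‖ ≤ ε := by
  obtain ⟨K, hK0, hK⟩ := Lp.exists_eLpNorm_le (μ := (volume : Measure (AddCircle L))) E hq2
  set b := K * |M| with hb
  have hb0 : 0 ≤ b := by positivity
  -- The interpolation bound vanishes as `η → 0` while the second-derivative bound `b` stays fixed.
  have hlim : Tendsto (fun η : ℝ => L⁻¹ * (η * b) + 2 * (√(η * b) * b)) (𝓝 0) (𝓝 0) := by
    have : Continuous (fun η : ℝ => L⁻¹ * (η * b) + 2 * (√(η * b) * b)) := by fun_prop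
    simpa using this.tendsto 0
  obtain ⟨η, hη, hη0⟩ := ((((hlim.mono_left nhdsWithin_le_nhds).eventually
    (gt_mem_nhds (show (0 : ℝ) < ε ^ 2 by positivity))).and
    (self_mem_nhdsWithin : Set.Ioi (0 : ℝ) ∈ 𝓝[>] 0))).exists
  refine ⟨η, hη0, fun u hu hη' => ?_⟩
  have hu2 := (SobolevTwo.memLp_toFun u).mono_exponent hq2
  have hw2 := (SobolevTwo.memLp_d2 u).mono_exponent hq2
  filter_upwards [ae_norm_sq_le_of_hasWeakDeriv hu2 ((SobolevTwo.memLp_d1 u).mono_exponent hq2) hw2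
    (SobolevTwo.hasWeakDeriv_toFun u) (SobolevTwo.hasWeakDeriv_d1 u)
    (a := η) (b := b) (le_of_lt hη0) hb0
    (by
      rw [integral_norm_sq_eq hu2]
      gcongr
      exact ENNReal.toReal_le_of_le_ofReal (le_of_lt hη0) hη')
    (by
      rw [integral_norm_sq_eq hw2]
      gcongr
      refine (hK u.1.2.2).trans ?_
      rw [hb]
      gcongr
      exact (SobolevTwo.norm_snd_snd_le u).trans (hu.trans (le_abs_self M)))] with x hx
  exact (sq_le_sq₀ (norm_nonneg _) hε.le).1 (hx.trans (le_of_lt hη))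

end SobolevTwo

theorem curvature_eq_curvatureOf (u : SobolevTwo L E q) :
    curvature u = fun x => curvatureOf (SobolevTwo.d1 u x) (SobolevTwo.d2 u x) := rfl

theorem memLp_curvature {c : ℝ} (hc : 0 < c) {u : SobolevTwo L E q}
    (hu : ∀ᵐ x, c ≤ ‖SobolevTwo.d1 u x‖) : MemLp (curvature u) q := by
  rw [curvature_eq_curvatureOf]
  refine ((SobolevTwo.memLp_d2 u).norm.const_mul (2 / c ^ 2)).mono'
    ((SobolevTwo.memLp_d1 u).1.curvatureOf (SobolevTwo.memLp_d2 u).1) ?_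
  filter_upwards [hu] with x hx using norm_curvatureOf_le hc _ hx

theorem coeFn_curvatureLp {c : ℝ} (hc : 0 < c) {u : SobolevTwo L E q}
    (hu : ∀ᵐ x, c ≤ ‖SobolevTwo.d1 u x‖) : curvatureLp u =ᵐ[volume] curvature u := by
  rw [curvatureLp, dif_pos (memLp_curvature hc hu)]
  exact MemLp.coeFn_toLp _

theorem norm_curvatureLp_le {c : ℝ} (hc : 0 < c) {u : SobolevTwo L E q}
    (hu : ∀ᵐ x, c ≤ ‖SobolevTwo.d1 u x‖) : ‖curvatureLp u‖ ≤ 2 / c ^ 2 * ‖u‖ := by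
  refine (Lp.norm_le_mul_norm_of_ae_le_mul (g := u.1.2.2) ?_).trans
    (mul_le_mul_of_nonneg_left (SobolevTwo.norm_snd_snd_le u) (by positivity))
  filter_upwards [hu, coeFn_curvatureLp hc hu] with x hx h1
  rw [h1]
  exact norm_curvatureOf_le hc _ hx

theorem norm_curvatureLp_sub_le {c K : ℝ} (hc : 0 < c) (hK : 0 ≤ K) {u v : SobolevTwo L E q}
    (hu : ∀ᵐ x, c ≤ ‖SobolevTwo.d1 u x‖) (hv : ∀ᵐ x, c ≤ ‖SobolevTwo.d1 v x‖)
    (huv : ∀ᵐ x, ‖SobolevTwo.d1 (u - v) x‖ ≤ K * ‖u - v‖) :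
    ‖curvatureLp u - curvatureLp v‖ ≤ (8 / c ^ 3 * K * ‖u‖ + 2 / c ^ 2) * ‖u - v‖ := by
  set N₁ : Lp ℝ q (volume : Measure (AddCircle L)) := (SobolevTwo.memLp_d2 u).norm.toLp _ with hN₁
  set N₂ : Lp ℝ q (volume : Measure (AddCircle L)) :=
    (SobolevTwo.memLp_d2 (u - v)).norm.toLp _ with hN₂
  have hn₁ : ‖N₁‖ ≤ ‖u‖ := by
    rw [hN₁, Lp.norm_toLp, eLpNorm_norm]; exact (SobolevTwo.norm_snd_snd_le u)
  have hn₂ : ‖N₂‖ ≤ ‖u - v‖ := by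
    rw [hN₂, Lp.norm_toLp, eLpNorm_norm]; exact (SobolevTwo.norm_snd_snd_le (u - v))
  set a := 8 / c ^ 3 * (K * ‖u - v‖) with ha
  have ha0 : 0 ≤ a := by positivity
  have hb0 : 0 ≤ 2 / c ^ 2 := by positivity
  have key : ‖curvatureLp u - curvatureLp v‖ ≤ ‖a • N₁ + (2 / c ^ 2) • N₂‖ := by
    refine Lp.norm_le_norm_of_ae_le ?_
    filter_upwards [hu, hv, huv, coeFn_curvatureLp hc hu, coeFn_curvatureLp hc hv,
      Lp.coeFn_sub (curvatureLp u) (curvatureLp v), SobolevTwo.d1_sub_ae u v,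
      SobolevTwo.d2_sub_ae u v, Lp.coeFn_add (a • N₁) ((2 / c ^ 2) • N₂), Lp.coeFn_smul a N₁,
      Lp.coeFn_smul (2 / c ^ 2) N₂, (SobolevTwo.memLp_d2 u).norm.coeFn_toLp,
      (SobolevTwo.memLp_d2 (u - v)).norm.coeFn_toLp]
      with x h1 h2 h3 h4 h5 h6 h7 h8 h9 h10 h11 h12 h13
    rw [h6, Pi.sub_apply, h4, h5, h9, Pi.add_apply, h10, h11, Pi.smul_apply, Pi.smul_apply, h12,
      h13, h8]
    rw [h7] at h3
    refine (norm_curvatureOf_sub_le hc _ _ h1 h2).trans (le_trans ?_ (le_abs_self _))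
    rw [smul_eq_mul, smul_eq_mul, ha]
    gcongr
  refine key.trans ((norm_add_le _ _).trans ?_)
  rw [norm_smul, norm_smul, Real.norm_of_nonneg ha0, Real.norm_of_nonneg hb0]
  calc _ ≤ a * ‖u‖ + 2 / c ^ 2 * ‖u - v‖ := by gcongr
    _ = _ := by rw [ha]; ring

/-- Needed to make the curvature strongly measurable as a function of time with values in `L^q`. -/
theorem continuousOn_curvatureLp [CompleteSpace E] {c : ℝ} (hc : 0 < c) :
    ContinuousOn (curvatureLp : SobolevTwo L E q → _)
      {u | ∀ᵐ x, c ≤ ‖SobolevTwo.d1 u x‖} := by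
  obtain ⟨K, hK0, hK⟩ := SobolevTwo.exists_ae_norm_d1_le L E q
  intro u hu
  rw [ContinuousWithinAt, tendsto_iff_norm_sub_tendsto_zero]
  have hlim : Tendsto (fun v => (8 / c ^ 3 * K * ‖u‖ + 2 / c ^ 2) * ‖u - v‖)
      (𝓝[{u : SobolevTwo L E q | ∀ᵐ x, c ≤ ‖SobolevTwo.d1 u x‖}] u) (𝓝 0) := by
    have : Continuous fun v : SobolevTwo L E q =>
      (8 / c ^ 3 * K * ‖u‖ + 2 / c ^ 2) * ‖u - v‖ := by fun_prop
    have h := (this.tendsto u).mono_left (nhdsWithin_le_nhds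
      (s := {u : SobolevTwo L E q | ∀ᵐ x, c ≤ ‖SobolevTwo.d1 u x‖}))
    rwa [sub_self, norm_zero, mul_zero] at h
  refine squeeze_zero' (Eventually.of_forall fun _ => norm_nonneg _) ?_ hlim
  filter_upwards [self_mem_nhdsWithin] with v hv
  rw [norm_sub_rev]
  exact norm_curvatureLp_sub_le hc hK0 hu hv (hK _)

end Curves

/-! ### The stability estimate in terms of Sobolev norms. -/

section FixedTime

variable {L : ℝ} [hL : Fact (0 < L)] {E : Type*} [NormedAddCommGroup E] [InnerProductSpace ℝ E]

/-- Only `v` needs a norm bound, since in the error term the curvature of `v` alone occurs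
undifferenced. -/
theorem exists_norm_curvatureLp_sub_rpow_le [CompleteSpace E] {p : ℝ}
    [hq : Fact (1 ≤ ENNReal.ofReal p)] (hp : 2 < p) {c M : ℝ} (hc : 0 < c) (hM : 0 ≤ M) :
    ∃ C, 0 ≤ C ∧ ∀ (u v : SobolevTwo L E (ENNReal.ofReal p)) (U V : SobolevOne L E 1) (δ : ℝ),
      0 ≤ δ → ‖v‖ ≤ M → (∀ᵐ x, c ≤ ‖SobolevTwo.d1 u x‖) → (∀ᵐ x, c ≤ ‖SobolevTwo.d1 v x‖) →
      (SobolevOne.toFun U =ᵐ[volume] fun x => ‖curvature u x‖ ^ (p - 2) • curvature u x) →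
      (SobolevOne.toFun V =ᵐ[volume] fun x => ‖curvature v x‖ ^ (p - 2) • curvature v x) →
      (∀ᵐ x, ‖SobolevTwo.d1 (u - v) x‖ ≤ δ) →
      ‖curvatureLp u - curvatureLp v‖ ^ p ≤ C * δ * (‖U‖ + ‖V‖) := by
  obtain ⟨K, hK0, hK⟩ := Lp.exists_integral_norm_le (μ := (volume : Measure (AddCircle L))) E hq.out
  have hL0 := hL.out
  refine ⟨c⁻¹ * (2 ^ (p - 1) * (2 / c + (L⁻¹ + 1) * (2 / c ^ 2) * (K * M))), by positivity,
    fun u v U V δ hδ hv hcu hcv hU hV huv => ?_⟩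
  have h1 : (1 : ℝ≥0∞) ≤ 1 := le_rfl
  have hδ' : ∀ᵐ x, ‖SobolevTwo.d1 u x - SobolevTwo.d1 v x‖ ≤ δ := by
    filter_upwards [huv, SobolevTwo.d1_sub_ae u v] with x hx hx'
    rwa [← hx']
  have key := integral_curvatureOf_sub_rpow_le hp hc hδ ((SobolevTwo.memLp_d1 u).integrable hq.out)
    ((SobolevTwo.memLp_d2 u).integrable hq.out) ((SobolevTwo.memLp_d1 v).integrable hq.out)
    ((SobolevTwo.memLp_d2 v).integrable hq.out)
    ((Lp.memLp U.1.1).integrable h1) ((Lp.memLp U.1.2).integrable h1)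
    ((Lp.memLp V.1.1).integrable h1) ((Lp.memLp V.1.2).integrable h1)
    (SobolevTwo.hasWeakDeriv_d1 u) (SobolevTwo.hasWeakDeriv_d1 v) U.2 V.2 hcu hcv hδ' hU hV
  have hnorm : ∫ x, ‖curvatureOf (SobolevTwo.d1 u x) (SobolevTwo.d2 u x)
      - curvatureOf (SobolevTwo.d1 v x) (SobolevTwo.d2 v x)‖ ^ p
      = ‖curvatureLp u - curvatureLp v‖ ^ p := by
    rw [Lp.norm_def, ← (Lp.memLp (curvatureLp u - curvatureLp v)).integral_norm_rpow_eq
      (by linarith)]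
    refine integral_congr_ae ?_
    filter_upwards [coeFn_curvatureLp hc hcu, coeFn_curvatureLp hc hcv,
      Lp.coeFn_sub (curvatureLp u) (curvatureLp v)] with x e1 e2 e3
    rw [e3, Pi.sub_apply, e1, e2]
    rfl
  have hL1 : ∀ f g : Lp E 1 (volume : Measure (AddCircle L)), ∫ x, ‖f x - g x‖ ≤ ‖f‖ + ‖g‖ := by
    intro f g
    refine le_trans (le_of_eq ?_) (norm_sub_le f g)
    rw [L1.norm_eq_integral_norm]
    refine integral_congr_ae ?_
    filter_upwards [Lp.coeFn_sub f g] with x hx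
    rw [hx, Pi.sub_apply]
  have hg : ∫ x, ‖U.1.2 x - V.1.2 x‖ ≤ ‖U‖ + ‖V‖ :=
    (hL1 _ _).trans (add_le_add (norm_snd_le U.1) (norm_snd_le V.1))
  have hh : ∫ x, ‖U.1.1 x - V.1.1 x‖ ≤ ‖U‖ + ‖V‖ :=
    (hL1 _ _).trans (add_le_add (norm_fst_le U.1) (norm_fst_le V.1))
  have hw : ∫ x, ‖SobolevTwo.d2 v x‖ ≤ K * M :=
    (hK v.1.2.2).trans (by gcongr; exact (SobolevTwo.norm_snd_snd_le v).trans hv)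
  rw [hnorm] at key
  set S := ‖U‖ + ‖V‖ with hS
  have hS0 : 0 ≤ S := by positivity
  have hle : c * ‖curvatureLp u - curvatureLp v‖ ^ p
      ≤ 2 ^ (p - 1) * (2 / c * δ * S + (L⁻¹ * S + S) * δ * (2 / c ^ 2) * (K * M)) := by
    refine key.trans ?_
    gcongr
  calc ‖curvatureLp u - curvatureLp v‖ ^ p
      = c⁻¹ * (c * ‖curvatureLp u - curvatureLp v‖ ^ p) := by field_simp
    _ ≤ c⁻¹ * (2 ^ (p - 1) * (2 / c * δ * S + (L⁻¹ * S + S) * δ * (2 / c ^ 2) * (K * M))) := by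
        gcongr
    _ = _ := by ring

end FixedTime

/-! ### Compactness in `L²`, uniformly in time. -/

section Compactness

variable {L : ℝ} [hL : Fact (0 < L)] {E : Type*} [NormedAddCommGroup E]

open BoundedContinuousFunction in
theorem isCompact_lipschitz_ball {X : Type*} [PseudoMetricSpace X] [CompactSpace X]
    [ProperSpace E] (R : ℝ) :
    IsCompact {F : X →ᵇ E | (∀ x, ‖F x‖ ≤ R) ∧ ∀ x y, dist (F x) (F y) ≤ R * dist x y} := by
  refine arzela_ascoli₂ (Metric.closedBall 0 R) (isCompact_closedBall 0 R) _ ?_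
    (fun F x hF => mem_closedBall_zero_iff.2 (hF.1 x)) ?_
  · simp only [Set.ofPred_and, Set.ofPred_forall]
    refine IsClosed.inter (isClosed_iInter fun x => ?_)
      (isClosed_iInter fun x => isClosed_iInter fun y => ?_)
    · exact isClosed_le (continuous_eval_const x).norm continuous_const
    · exact isClosed_le ((continuous_eval_const x).dist (continuous_eval_const y))
        continuous_const
  · refine Metric.equicontinuous_of_continuity_modulus (fun r => R * r) ?_ _ fun x y F => F.2.2 x y
    have : Continuous fun r : ℝ => R * r := by fun_prop
    simpa using this.tendsto 0

variable [InnerProductSpace ℝ E] {q : ℝ≥0∞} [hq : Fact (1 ≤ q)]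

open BoundedContinuousFunction in
theorem SobolevTwo.exists_lipschitz_representative [CompleteSpace E] (M : ℝ) :
    ∃ R : ℝ, ∀ u : SobolevTwo L E q, ‖u‖ ≤ M → ∃ F : Set.Icc (0 : ℝ) L →ᵇ E,
      ((∀ x, ‖F x‖ ≤ R) ∧ ∀ x y, dist (F x) (F y) ≤ R * dist x y) ∧
      ∀ᵐ x : ℝ, ∀ hx : x ∈ Set.Ioc 0 L,
        SobolevTwo.toFun u (x : AddCircle L) = F ⟨x, Set.Ioc_subset_Icc_self hx⟩ := by
  obtain ⟨K, hK0, hK⟩ := SobolevTwo.exists_ae_norm_d1_le L E q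
  obtain ⟨K', hK'0, hK'⟩ :=
    Lp.exists_integral_norm_le (μ := (volume : Measure (AddCircle L))) E hq.out
  have hle := hL.out.le
  have hL0 := hL.out
  -- The first entry bounds the Lipschitz constant, the second the sup norm.
  refine ⟨max (K * M) (L⁻¹ * (K' * M) + K' * M), fun u hu => ?_⟩
  obtain ⟨F, hF, -, huF⟩ := (hasWeakDeriv_toFun u).exists_isPrimitiveOn
    ((memLp_toFun u).integrable hq.out) ((memLp_d1 u).integrable hq.out)
  have hd1 : ∀ᵐ x : ℝ, x ∈ Set.Ioc 0 L → ‖d1 u (x : AddCircle L)‖ ≤ K * M :=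
    AddCircle.ae_iff_ae_Ioc.1 ((hK u).mono fun x hx => hx.trans (by gcongr))
  refine ⟨mkOfCompact ⟨fun x => F x, hF.continuousOn.domRestrict⟩, ⟨fun x => ?_, fun x y => ?_⟩, ?_⟩
  · refine (hF.norm_le hL.out x.2).trans (le_trans ?_ (le_max_right _ _))
    rw [intervalIntegral_norm_congr_of_ae huF (fun v _ => ‖v‖),
      ← AddCircle.integral_eq_intervalIntegral (fun x => ‖toFun u x‖),
      ← AddCircle.integral_eq_intervalIntegral (fun x => ‖d1 u x‖)]
    gcongr
    · exact (hK' u.1.1).trans (by gcongr; exact (SobolevTwo.norm_fst_le u).trans hu)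
    · exact (hK' u.1.2.1).trans (by gcongr; exact (SobolevTwo.norm_snd_fst_le u).trans hu)
  · wlog hxy : (x : ℝ) ≤ y generalizing x y
    · rw [dist_comm, dist_comm x]; exact this y x (le_of_not_ge hxy)
    refine le_trans ?_ (mul_le_mul_of_nonneg_right (le_max_left _ _) dist_nonneg)
    rw [dist_comm, dist_eq_norm, Subtype.dist_eq, Real.dist_eq, abs_sub_comm]
    change ‖F y - F x‖ ≤ _
    rw [hF.sub_eq_integral x.2 y.2]
    refine intervalIntegral.norm_integral_le_of_norm_le_const_ae ?_
    rw [Set.uIoc_of_le hxy]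
    filter_upwards [hd1] with t ht htI
    exact ht ⟨x.2.1.trans_lt htI.1, htI.2.trans y.2.2⟩
  · filter_upwards [huF] with x hx hxI using hx hxI

/-- A Rellich-type compactness result, simultaneously at countably many times. -/
theorem SobolevTwo.exists_subseq_cauchy_of_countable [CompleteSpace E] [ProperSpace E]
    {ι : Type*} [Countable ι] {M : ℝ} (u : ℕ → ι → SobolevTwo L E q) (hu : ∀ n i, ‖u n i‖ ≤ M) :
    ∃ ns : ℕ → ℕ, StrictMono ns ∧ ∀ i, ∀ ε : ℝ, 0 < ε → ∃ N, ∀ j, N ≤ j → ∀ k, N ≤ k →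
      eLpNorm (toFun (u (ns j) i - u (ns k) i)) 2 volume ≤ ENNReal.ofReal ε := by
  obtain ⟨R, hR⟩ := SobolevTwo.exists_lipschitz_representative (L := L) (E := E) (q := q) M
  choose F hF using fun n i => hR (u n i) (hu n i)
  -- Tychonoff on a countable product of compact metric sets replaces the diagonal argument.
  obtain ⟨a, -, ns, hns, hlim⟩ := (isCompact_univ_pi fun _ : ι =>
    isCompact_lipschitz_ball (X := Set.Icc (0 : ℝ) L) (E := E) R).tendsto_subseq
      (x := F) (fun n i _ => (hF n i).1)
  refine ⟨ns, hns, fun i ε hε => ?_⟩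
  have hi : Tendsto (fun j => F (ns j) i) atTop (𝓝 (a i)) := (tendsto_pi_nhds.1 hlim) i
  set V : ℝ≥0∞ := (volume : Measure (AddCircle L)) Set.univ ^ (2 : ℝ≥0∞).toReal⁻¹ with hV
  have hVt : V ≠ ⊤ := ENNReal.rpow_ne_top_of_nonneg (by positivity) (measure_ne_top _ _)
  have hε' : 0 < ε / (V.toReal + 1) := by positivity
  obtain ⟨N, hN⟩ := Metric.cauchySeq_iff.1 hi.cauchySeq _ hε'
  refine ⟨N, fun j hj k hk => ?_⟩
  have hbound : ∀ᵐ x, ‖toFun (u (ns j) i - u (ns k) i) x‖ ≤ ε / (V.toReal + 1) := by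
    have h : ∀ᵐ x : AddCircle L, ‖toFun (u (ns j) i) x - toFun (u (ns k) i) x‖
        ≤ ε / (V.toReal + 1) := by
      rw [AddCircle.ae_iff_ae_Ioc]
      filter_upwards [(hF (ns j) i).2, (hF (ns k) i).2] with x h1 h2 hx
      rw [h1 hx, h2 hx, ← dist_eq_norm]
      exact (BoundedContinuousFunction.dist_coe_le_dist _).trans (hN j hj k hk).le
    filter_upwards [h, toFun_sub_ae (u (ns j) i) (u (ns k) i)] with x h1 h2
    rwa [h2]
  refine (eLpNorm_le_of_ae_bound hbound).trans ?_
  rw [← hV, ← ENNReal.ofReal_toReal hVt, ← ENNReal.ofReal_mul ENNReal.toReal_nonneg]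
  refine ENNReal.ofReal_le_ofReal ?_
  rw [ENNReal.toReal_ofReal ENNReal.toReal_nonneg, mul_div_assoc', div_le_iff₀ (by positivity)]
  nlinarith [ENNReal.toReal_nonneg (a := V)]

/-- A subsequence converges in `L²`, uniformly in time. -/
theorem SobolevTwo.exists_subseq_uniformly_cauchy [CompleteSpace E] [ProperSpace E] {M T : ℝ}
    (u : ℕ → ℝ → SobolevTwo L E q) {G : Set ℝ} (hG : G ⊆ Set.Ico 0 T)
    (hu : ∀ n, ∀ t ∈ G, ‖u n t‖ ≤ M)
    (hhol : BoundedInHolderHalf T (fun n t => toFun (u n t))) :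
    ∃ ns : ℕ → ℕ, StrictMono ns ∧ ∀ ε : ℝ, 0 < ε → ∃ N, ∀ j, N ≤ j → ∀ k, N ≤ k → ∀ t ∈ G,
      eLpNorm (toFun (u (ns j) t - u (ns k) t)) 2 volume ≤ ENNReal.ofReal ε := by
  obtain ⟨C, hC⟩ := hhol
  have hGb : TotallyBounded G := (totallyBounded_Ico 0 T).subset hG
  -- The nets are taken inside `G` because the norm bounds are known only there.
  choose net hnetG hnetfin hnet using fun m : ℕ =>
    Metric.finite_approx_of_totallyBounded hGb ((1 : ℝ) / (m + 1)) (by positivity)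
  set D : Set ℝ := ⋃ m, net m with hD
  have hDG : D ⊆ G := Set.iUnion_subset hnetG
  have : Countable D := (Set.countable_iUnion fun m => (hnetfin m).countable).to_subtype
  obtain ⟨ns, hns, hcau⟩ := SobolevTwo.exists_subseq_cauchy_of_countable
    (fun n (t : D) => u n t) (fun n t => hu n t (hDG t.2))
  refine ⟨ns, hns, fun ε hε => ?_⟩
  -- A mesh so fine that the Hölder bound costs at most `ε / 3` when moving from `t` to a net point.
  obtain ⟨η, hη0, hη⟩ : ∃ η : ℝ, 0 < η ∧ (C : ℝ) * √η ≤ ε / 3 := by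
    refine ⟨(ε / 3 / (C + 1)) ^ 2, by positivity, ?_⟩
    rw [Real.sqrt_sq (by positivity), mul_div_assoc', div_le_iff₀ (by positivity)]
    nlinarith [C.coe_nonneg]
  obtain ⟨m, hm⟩ := exists_nat_one_div_lt hη0
  have hfin : ∃ N, ∀ s ∈ net m, ∀ j, N ≤ j → ∀ k, N ≤ k →
      eLpNorm (toFun (u (ns j) s - u (ns k) s)) 2 volume ≤ ENNReal.ofReal (ε / 3) := by
    have hev : ∀ s ∈ net m, ∀ᶠ N in atTop, ∀ j, N ≤ j → ∀ k, N ≤ k →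
        eLpNorm (toFun (u (ns j) s - u (ns k) s)) 2 volume ≤ ENNReal.ofReal (ε / 3) := by
      intro s hs
      obtain ⟨N, hN⟩ := hcau ⟨s, Set.mem_iUnion.2 ⟨m, hs⟩⟩ (ε / 3) (by positivity)
      filter_upwards [eventually_ge_atTop N] with N' hN' j hj k hk
      exact hN j (hN'.trans hj) k (hN'.trans hk)
    exact ((hnetfin m).eventually_all.2 hev).exists
  obtain ⟨N, hN⟩ := hfin
  refine ⟨N, fun j hj k hk t ht => ?_⟩
  obtain ⟨s, hs, hts⟩ := Set.mem_iUnion₂.1 (hnet m ht)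
  have hsG := hnetG m hs
  have hmeas : ∀ v : SobolevTwo L E q, AEStronglyMeasurable (toFun v) volume :=
    fun v => (memLp_toFun v).1
  have htime : ∀ n, eLpNorm (toFun (u n t) - toFun (u n s)) 2 volume ≤ ENNReal.ofReal (ε / 3) := by
    intro n
    refine ((hC n).2 t (hG ht) s (hG hsG)).trans ?_
    rw [← ENNReal.ofReal_coe_nnreal, ← ENNReal.ofReal_mul C.coe_nonneg]
    refine ENNReal.ofReal_le_ofReal (le_trans ?_ hη)
    gcongr
    rw [Metric.mem_ball, Real.dist_eq] at hts
    exact hts.le.trans hm.le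
  have e : toFun (u (ns j) t - u (ns k) t) =ᵐ[volume]
      (toFun (u (ns j) t) - toFun (u (ns j) s)) + toFun (u (ns j) s - u (ns k) s)
        - (toFun (u (ns k) t) - toFun (u (ns k) s)) := by
    filter_upwards [toFun_sub_ae (u (ns j) t) (u (ns k) t),
      toFun_sub_ae (u (ns j) s) (u (ns k) s)] with x h1 h2
    simp only [Pi.add_apply, Pi.sub_apply, h1, h2]
    abel
  rw [eLpNorm_congr_ae e]
  refine (eLpNorm_sub_le (((hmeas _).sub (hmeas _)).add (hmeas _)) ((hmeas _).sub (hmeas _))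
    one_le_two).trans ?_
  refine (add_le_add (eLpNorm_add_le ((hmeas _).sub (hmeas _)) (hmeas _) one_le_two)
    (htime _)).trans ?_
  refine (add_le_add (add_le_add (htime _) (hN s hs j hj k hk)) le_rfl).trans ?_
  rw [← ENNReal.ofReal_add (by positivity) (by positivity),
    ← ENNReal.ofReal_add (by positivity) (by positivity)]
  exact ENNReal.ofReal_le_ofReal (by linarith)

end Compactness

/-! ### Bochner spaces in time and the conclusion. -/

/-- Redefining `f` on a null set, by one of its values in `s`, puts all values in `s`; then `g`
restricted to `s` is an honest continuous function to compose with. -/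
theorem ContinuousOn.comp_aestronglyMeasurable_of_ae_mem {α X Y : Type*} [MeasurableSpace α]
    {μ : Measure α} [TopologicalSpace X] [TopologicalSpace.PseudoMetrizableSpace X]
    [TopologicalSpace Y] [TopologicalSpace.PseudoMetrizableSpace Y] {g : X → Y} {s : Set X}
    (hg : ContinuousOn g s) {f : α → X} (hf : AEStronglyMeasurable f μ) (hs : ∀ᵐ t ∂μ, f t ∈ s) :
    AEStronglyMeasurable (fun t => g (f t)) μ := by
  classical
  rcases eq_or_ne μ 0 with rfl | hμ
  · exact aestronglyMeasurable_zero_measure _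
  have : (ae μ).NeBot := ae_neBot.2 hμ
  obtain ⟨t₀, ht₀⟩ := hs.exists
  set f₀ := hf.mk f with hf₀
  have hs₀ : ∀ᵐ t ∂μ, f₀ t ∈ s := by
    filter_upwards [hs, hf.ae_eq_mk] with t h1 h2
    rwa [hf₀, ← h2]
  set N := toMeasurable μ {t | ¬ f₀ t ∈ s} with hN
  have hNm : MeasurableSet N := measurableSet_toMeasurable _ _
  have hN0 : μ N = 0 := by rw [hN, measure_toMeasurable]; exact ae_iff.1 hs₀
  set f₁ : α → X := N.piecewise (fun _ => f t₀) f₀ with hf₁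
  have hf₁m : StronglyMeasurable f₁ :=
    StronglyMeasurable.piecewise hNm stronglyMeasurable_const hf.stronglyMeasurable_mk
  have hf₁s : ∀ t, f₁ t ∈ s := by
    intro t
    by_cases ht : t ∈ N
    · rw [hf₁, Set.piecewise_eq_of_mem _ _ _ ht]; exact ht₀
    · rw [hf₁, Set.piecewise_eq_of_notMem _ _ _ ht]
      by_contra h
      exact ht (subset_toMeasurable _ _ h)
  have hf₁' : StronglyMeasurable (fun t => (⟨f₁ t, hf₁s t⟩ : s)) :=
    (Embedding.comp_stronglyMeasurable_iff Topology.IsEmbedding.subtypeVal).1 hf₁m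
  refine ⟨fun t => g (f₁ t),
    (continuousOn_iff_continuous_domRestrict.1 hg).comp_stronglyMeasurable hf₁', ?_⟩
  filter_upwards [hf.ae_eq_mk, compl_mem_ae_iff.2 hN0] with t h1 h2
  rw [hf₁, Set.piecewise_eq_of_notMem _ _ _ h2, hf₀, ← h1]

instance isFiniteMeasure_timeMeasure (T : ℝ) : IsFiniteMeasure (timeMeasure T) := by
  unfold timeMeasure; infer_instance

theorem MeasureTheory.Lp.exists_tendsto_eLpNorm_of_cauchy {α X : Type*} [MeasurableSpace α]
    {μ : Measure α} [NormedAddCommGroup X] [CompleteSpace X] {r : ℝ≥0∞} [Fact (1 ≤ r)]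
    {f : ℕ → α → X} (hf : ∀ n, MemLp (f n) r μ)
    (hc : ∀ ε : ℝ, 0 < ε → ∃ N, ∀ j, N ≤ j → ∀ k, N ≤ k →
      eLpNorm (f j - f k) r μ ≤ ENNReal.ofReal ε) :
    ∃ g : α → X, MemLp g r μ ∧ Tendsto (fun j => eLpNorm (fun t => f j t - g t) r μ) atTop (𝓝 0) := by
  have hcau : CauchySeq fun n => (hf n).toLp (f n) := by
    refine Metric.cauchySeq_iff.2 fun ε hε => ?_
    obtain ⟨N, hN⟩ := hc (ε / 2) (by positivity)
    refine ⟨N, fun j hj k hk => ?_⟩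
    rw [_root_.dist_eq_norm, ← MemLp.toLp_sub, Lp.norm_toLp]
    exact (ENNReal.toReal_le_of_le_ofReal (by positivity) (hN j hj k hk)).trans_lt (by linarith)
  obtain ⟨g, hg⟩ := cauchySeq_tendsto_of_complete hcau
  refine ⟨g, Lp.memLp g, ?_⟩
  have h := (Lp.tendsto_Lp_iff_tendsto_eLpNorm' _ _).1 hg
  refine h.congr fun j => eLpNorm_congr_ae ?_
  filter_upwards [(hf j).coeFn_toLp] with t ht
  rw [Pi.sub_apply, ht]

/-- A `p`-th root that trades `b ^ p⁻¹` for `1 + b`, so that the square integrability in time of `b`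
can be used directly. -/
theorem Real.le_rpow_inv_mul_of_rpow_le {x a b p : ℝ} (hx : 0 ≤ x) (ha : 0 ≤ a) (hb : 0 ≤ b)
    (hp : 1 ≤ p) (h : x ^ p ≤ a * b) : x ≤ a ^ p⁻¹ * (1 + b) := by
  have hp0 : 0 < p := by linarith
  refine (Real.rpow_le_rpow_iff hx (by positivity) hp0).1 ?_
  rw [Real.mul_rpow (by positivity) (by positivity), Real.rpow_inv_rpow ha hp0.ne']
  refine h.trans (mul_le_mul_of_nonneg_left ?_ ha)
  calc b ≤ (1 + b) ^ (1 : ℝ) := by rw [Real.rpow_one]; linarith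
    _ ≤ (1 + b) ^ p := Real.rpow_le_rpow_of_exponent_le (by linarith) hp

/-- The curvature is essentially bounded in time and the time interval has finite measure, so every
exponent `r` is allowed. -/
theorem memLp_curvatureLp_timeMeasure {L T c M : ℝ} [Fact (0 < L)] {E : Type*}
    [NormedAddCommGroup E] [InnerProductSpace ℝ E] [CompleteSpace E] {q r : ℝ≥0∞} [Fact (1 ≤ q)]
    {u : ℝ → SobolevTwo L E q} (hc : 0 < c) (hu : AEStronglyMeasurable u (timeMeasure T))
    (hM : ∀ᵐ t ∂(timeMeasure T), ‖u t‖ ≤ M)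
    (hreg : ∀ᵐ t ∂(timeMeasure T), ∀ᵐ x, c ≤ ‖SobolevTwo.d1 (u t) x‖) :
    MemLp (fun t => curvatureLp (u t)) r (timeMeasure T) := by
  refine MemLp.of_bound ((continuousOn_curvatureLp hc).comp_aestronglyMeasurable_of_ae_mem hu hreg)
    (2 / c ^ 2 * M) ?_
  filter_upwards [hM, hreg] with t h1 h2
  refine (norm_curvatureLp_le hc h2).trans ?_
  gcongr

/-- The curvatures of uniformly regular curves, bounded in `L^∞ W^{2,p}` and with
`‖κ‖ ^ (p - 2) κ` bounded in `L² W^{1,1}`, form a Cauchy sequence in `L² L^p` as soon as the curves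
form a Cauchy sequence in `L²`, uniformly in time. -/
theorem exists_eLpNorm_curvatureLp_sub_le {L T c M p : ℝ} [Fact (0 < L)] {E : Type*}
    [NormedAddCommGroup E] [InnerProductSpace ℝ E] [CompleteSpace E]
    [hq : Fact (1 ≤ ENNReal.ofReal p)] (hp : 2 < p) (hc : 0 < c) (hM : 0 ≤ M)
    {u : ℕ → ℝ → SobolevTwo L E (ENNReal.ofReal p)} {U : ℕ → ℝ → SobolevOne L E 1}
    (hU : BoundedInBochner T 2 U)
    {G : Set ℝ} (hG : ∀ᵐ t ∂(timeMeasure T), t ∈ G) (huM : ∀ n, ∀ t ∈ G, ‖u n t‖ ≤ M)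
    (hreg : ∀ n, ∀ t ∈ G, ∀ᵐ x, c ≤ ‖SobolevTwo.d1 (u n t) x‖)
    (huU : ∀ n, ∀ t ∈ G, SobolevOne.toFun (U n t) =ᵐ[volume]
      fun x => ‖curvature (u n t) x‖ ^ (p - 2) • curvature (u n t) x)
    {ns : ℕ → ℕ} (hcau : ∀ ε : ℝ, 0 < ε → ∃ N, ∀ j, N ≤ j → ∀ k, N ≤ k → ∀ t ∈ G,
      eLpNorm (SobolevTwo.toFun (u (ns j) t - u (ns k) t)) 2 volume ≤ ENNReal.ofReal ε)
    {ε : ℝ} (hε : 0 < ε) : ∃ N, ∀ j, N ≤ j → ∀ k, N ≤ k →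
      eLpNorm ((fun t => curvatureLp (u (ns j) t)) - fun t => curvatureLp (u (ns k) t)) 2
        (timeMeasure T) ≤ ENNReal.ofReal ε := by
  obtain ⟨CU, hCU⟩ := hU
  obtain ⟨C, hC0, hC⟩ := exists_norm_curvatureLp_sub_rpow_le (L := L) (E := E) hp hc hM
  have hp0 : 0 < p := by linarith
  have hq2 : 2 ≤ ENNReal.ofReal p := by
    rw [← ENNReal.ofReal_ofNat 2]; exact ENNReal.ofReal_le_ofReal hp.le
  set A := eLpNorm (fun _ : ℝ => (1 : ℝ)) 2 (timeMeasure T) with hA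
  have hAt : A ≠ ⊤ := (memLp_const (1 : ℝ)).eLpNorm_ne_top
  -- A bound, uniform in `j` and `k`, for the `L²` norm in time of `1 + ‖U_j‖ + ‖U_k‖`.
  set B : ℝ≥0∞ := A + (CU + CU) with hB
  have hBt : B ≠ ⊤ := by simp [hB, hAt]
  obtain ⟨δ, hδ0, hδ⟩ : ∃ δ : ℝ, 0 < δ ∧ (C * δ) ^ p⁻¹ * B.toReal < ε := by
    have hlim : Tendsto (fun δ : ℝ => (C * δ) ^ p⁻¹ * B.toReal) (𝓝 0) (𝓝 0) := by
      have : Continuous (fun δ : ℝ => (C * δ) ^ p⁻¹ * B.toReal) :=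
        ((Real.continuous_rpow_const (inv_nonneg.2 hp0.le)).comp
          (continuous_const.mul continuous_id)).mul continuous_const
      simpa [Real.zero_rpow (inv_ne_zero hp0.ne')] using this.tendsto 0
    obtain ⟨δ, h1, h2⟩ := (((hlim.mono_left nhdsWithin_le_nhds).eventually
      (gt_mem_nhds hε)).and (self_mem_nhdsWithin : Set.Ioi (0 : ℝ) ∈ 𝓝[>] 0)).exists
    exact ⟨δ, h2, h1⟩
  obtain ⟨η, hη0, hη⟩ := SobolevTwo.exists_ae_norm_d1_le_of_eLpNorm_le (L := L) (E := E) hq2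
    (M + M) hδ0
  obtain ⟨N, hN⟩ := hcau η hη0
  refine ⟨N, fun j hj k hk => ?_⟩
  have hpt : ∀ᵐ t ∂(timeMeasure T), ‖curvatureLp (u (ns j) t) - curvatureLp (u (ns k) t)‖
      ≤ (C * δ) ^ p⁻¹ * ‖(1 : ℝ) + (‖U (ns j) t‖ + ‖U (ns k) t‖)‖ := by
    filter_upwards [hG] with t ht
    rw [Real.norm_of_nonneg (by positivity)]
    refine Real.le_rpow_inv_mul_of_rpow_le (norm_nonneg _) (by positivity) (by positivity)
      (by linarith) ?_
    refine hC _ _ _ _ δ hδ0.le (huM _ t ht) (hreg _ t ht) (hreg _ t ht) (huU _ t ht) (huU _ t ht)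
      (hη _ ?_ (hN j hj k hk t ht))
    exact (norm_sub_le _ _).trans (add_le_add (huM _ t ht) (huM _ t ht))
  refine (eLpNorm_le_mul_eLpNorm_of_ae_le_mul hpt 2).trans ?_
  have hsum : eLpNorm (fun t => (1 : ℝ) + (‖U (ns j) t‖ + ‖U (ns k) t‖)) 2 (timeMeasure T) ≤ B := by
    have hj1 := hCU (ns j)
    have hk1 := hCU (ns k)
    refine (eLpNorm_add_le aestronglyMeasurable_const (hj1.1.norm.add hk1.1.norm)
      one_le_two).trans (add_le_add le_rfl ?_)
    refine (eLpNorm_add_le hj1.1.norm hk1.1.norm one_le_two).trans ?_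
    rw [eLpNorm_norm, eLpNorm_norm]
    exact add_le_add hj1.2 hk1.2
  calc _ ≤ ENNReal.ofReal ((C * δ) ^ p⁻¹) * B := by gcongr
    _ = ENNReal.ofReal ((C * δ) ^ p⁻¹ * B.toReal) := by
      rw [ENNReal.ofReal_mul (by positivity), ENNReal.ofReal_toReal hBt]
    _ ≤ _ := ENNReal.ofReal_le_ofReal hδ.le

theorem theorem3p3 {d : ℕ} (L T p : ℝ) [Fact (0 < L)] (hT : 0 < T) (hp : 2 < p)
    [Fact (1 ≤ ENNReal.ofReal p)]
    (γ : SobolevTwo L (EuclideanSpace ℝ (Fin d)) (ENNReal.ofReal p))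
    (φ : ℕ → ℝ → SobolevTwo L (EuclideanSpace ℝ (Fin d)) (ENNReal.ofReal p))
    -- the curves `γ + φ n t` are uniformly regular
    (hreg : ∃ c : ℝ, 0 < c ∧ ∀ n, ∀ᵐ t ∂(timeMeasure T), ∀ᵐ x : AddCircle L,
      c ≤ ‖SobolevTwo.d1 (γ + φ n t) x‖)
    -- the sequence is bounded in `L^∞ W^{2,p}` and in `C^{1/2} L²`
    (hbdd : BoundedInBochner T ⊤ (fun n t => γ + φ n t))
    (hhol : BoundedInHolderHalf T (fun n t => SobolevTwo.toFun (γ + φ n t)))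
    -- `|κ_n|^{p-2} κ_n` is bounded in `L² W^{1,1}`
    (hcurv : ∃ U : ℕ → ℝ → SobolevOne L (EuclideanSpace ℝ (Fin d)) 1,
      BoundedInBochner T 2 U ∧
      ∀ n, ∀ᵐ t ∂(timeMeasure T), SobolevOne.toFun (U n t) =ᵐ[volume]
        fun x => ‖curvature (γ + φ n t) x‖ ^ (p - 2) • curvature (γ + φ n t) x) :
    -- the curvatures belong to `L² L^p`
    (∀ n, (∀ᵐ t ∂(timeMeasure T),
        MemLp (curvature (γ + φ n t)) (ENNReal.ofReal p) volume) ∧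
      MemLp (fun t => curvatureLp (γ + φ n t)) 2 (timeMeasure T)) ∧
    -- and a subsequence of them converges in `L² L^p`
    ∃ (ns : ℕ → ℕ) (κ : ℝ → Lp (EuclideanSpace ℝ (Fin d)) (ENNReal.ofReal p)
        (volume : Measure (AddCircle L))),
      StrictMono ns ∧ MemLp κ 2 (timeMeasure T) ∧
      Tendsto (fun j => eLpNorm (fun t => curvatureLp (γ + φ (ns j) t) - κ t) 2 (timeMeasure T))
        atTop (𝓝 0) := by
  obtain ⟨c, hc, hreg⟩ := hreg
  obtain ⟨M, hM⟩ := hbdd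
  obtain ⟨U, hU, hUκ⟩ := hcurv
  have hMae : ∀ n, ∀ᵐ t ∂(timeMeasure T), ‖γ + φ n t‖ ≤ M := by
    intro n
    have h := (hM n).2
    rw [eLpNorm_exponent_top] at h
    filter_upwards [ae_le_eLpNormEssSup (f := fun t => γ + φ n t) (μ := timeMeasure T)] with t ht
    exact_mod_cast enorm_le_coe.1 (ht.trans h)
  have hmem : ∀ n, MemLp (fun t => curvatureLp (γ + φ n t)) 2 (timeMeasure T) := fun n =>
    memLp_curvatureLp_timeMeasure hc (hM n).1 (hMae n) (hreg n)
  refine ⟨fun n => ⟨(hreg n).mono fun t ht => memLp_curvature hc ht, hmem n⟩, ?_⟩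
  -- The times at which all the almost-everywhere hypotheses hold for every `n` at once;
  -- countability of the sequence gives full measure.
  set G : Set ℝ := {t | t ∈ Set.Ico 0 T ∧ ∀ n, ‖γ + φ n t‖ ≤ M ∧
    (∀ᵐ x, c ≤ ‖SobolevTwo.d1 (γ + φ n t) x‖) ∧ SobolevOne.toFun (U n t) =ᵐ[volume]
      fun x => ‖curvature (γ + φ n t) x‖ ^ (p - 2) • curvature (γ + φ n t) x} with hG
  have hGae : ∀ᵐ t ∂(timeMeasure T), t ∈ G := by
    filter_upwards [ae_restrict_mem measurableSet_Ico, ae_all_iff.2 hMae, ae_all_iff.2 hreg,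
      ae_all_iff.2 hUκ] with t h1 h2 h3 h4
    exact ⟨h1, fun n => ⟨h2 n, h3 n, h4 n⟩⟩
  obtain ⟨ns, hns, hcau⟩ := SobolevTwo.exists_subseq_uniformly_cauchy
    (fun n t => γ + φ n t) (G := G) (fun t ht => ht.1) (fun n t ht => (ht.2 n).1) hhol
  obtain ⟨κ, hκ, hlim⟩ := Lp.exists_tendsto_eLpNorm_of_cauchy (r := 2) (fun j => hmem (ns j))
    (fun ε hε => exists_eLpNorm_curvatureLp_sub_le hp hc M.coe_nonneg hU hGae
      (fun n t ht => (ht.2 n).1) (fun n t ht => (ht.2 n).2.1) (fun n t ht => (ht.2 n).2.2) hcau hε)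
  exact ⟨ns, κ, hns, hκ, hlim⟩
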